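/- Let $S$ and $A$ be finite sets of states and actions ($A\neq\emptyset$), let $r:S\to[0,1]$ be a reward function, $\gamma\in(0,1)$, $0<\varepsilon\le \frac1{1-\gamma}$ and $\delta\in(0,1)$. A (non-stationary, deterministic) policy is a function $\pi$ mapping every finite non-empty history of states $s_{1:t}=s_1\dots s_t$ to an action. In an MDP $M=(S,A,p,r,\gamma)$ with transition probabilities $p_{s,a}^{s'}$, let $V^\pi(s_{1:t})=\mathbf E\big[\sum_{k\ge0}\gamma^k r(s_{t+k})\,\big|\,s_{1:t}\big]$ be the value of $\pi$ after the history $s_{1:t}$, and let $V^*(s)$ be the maximum over the stationary policies $S\to A$ of their value in the state $s$. Then there is a policy $\pi$, depending only on $S,A,r,\gamma,\varepsilon,\delta$ and not on the transition probabilities, such that for every transition function $p$ (each $p_{s,a}$ an arbitrary probability distribution on $S$, with no restriction on the number of possible next-states) and every start state $s_1$, with probability at least $1-\delta$ the sequence of states $s_1,s_2,\dots$ generated by $\pi$ in $M=(S,A,p,r,\gamma)$ satisfies $V^*(s_t)-V^\pi(s_{1:t})>\varepsilon$ for at most $$|S|\,\log^3|S|\,\big(E_{\max}H+U_{\max}H\big)$$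 time-steps $t$. Here $\log$ is the natural logarithm, $|S\times A|=|S||A|$ and $$H=\frac1{1-\gamma}\log\frac{8|S|}{\varepsilon(1-\gamma)},\quad U_{\max}=|S\times A|\,|\mathcal K\times\mathcal I|,\quad E_{\max}=4N|\mathcal K\times\mathcal I|,\quad N=6|S\times A|\,m,$$ $$m=\frac{20\,L_1\,|\mathcal K\times\mathcal I|\,|\mathcal D|^2}{\varepsilon^2(1-\gamma)^{2+2/\beta}},\quad L_1=\log\frac2{\delta_1},\quad \delta_1=\frac{\delta}{2|S\times A|U_{\max}},\quad \beta=\Big\lceil\frac1{2\log2}\log\frac1{1-\gamma}\Big\rceil,$$ $$\mathcal K=\mathcal Z(|S|),\quad \mathcal D=\mathcal Z(\beta),\quad \mathcal I=\{0,1,\dots,\iota_{\max}\},\quad \iota_{\max}=\Big\lceil\frac1{\log2}\log\frac{8|S|}{\varepsilon(1-\gamma)^2}\Big\rceil,$$ where $z_i=2^i-2$ and $\mathcal Z(a)=\{z_i:1\le i\le i_0\}$ with $i_0$ the least $i\ge1$ such that $z_i\ge a$. -/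

import Mathlib

open MeasureTheory ProbabilityTheory

noncomputable section

namespace PACMDP

/-- A discounted Markov decision process on the state space `S` and the action space `A`
(both are finite in everything that follows). `p s a` is the law of the next state when action `a`
is taken in state `s`. -/
structure MDP (S A : Type*) where
  p : S → A → PMF S
  r : S → ℝ
  γ : ℝ
  r_mem : ∀ s, r s ∈ Set.Icc (0 : ℝ) 1
  γ_mem : γ ∈ Set.Ioo (0 : ℝ) 1

/-- The history `s_0, …, s_n` of the states seen up to time `n`. -/
abbrev History (S : Type*) (n : ℕ) : Type _ := Finset.Iic n → S

/-- The last (i.e. current) state of a history. -/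
def History.last {S : Type*} {n : ℕ} (h : History S n) : S := h ⟨n, by simp⟩

/-- A (possibly non-stationary) policy: it maps every finite non-empty history of states to an
action. -/
abbrev Policy (S A : Type*) : Type _ := (n : ℕ) → History S n → A

/-- A stationary policy `S → A`, seen as a policy: it only looks at the current state. -/
def Policy.ofStationary {S A : Type*} (f : S → A) : Policy S A := fun _ h => f h.last

section Dynamics

variable {S A : Type*} [Fintype S] [MeasurableSpace S] [DiscreteMeasurableSpace S]

/-- The law of the next state given the history, when the policy `π` acts in the MDP `M`. -/
def stepKernel (M : MDP S A) (π : Policy S A) (n : ℕ) : Kernel (History S n) S :=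
  Kernel.ofFunOfCountable fun h => (M.p h.last (π n h)).toMeasure

instance (M : MDP S A) (π : Policy S A) (n : ℕ) : IsMarkovKernel (stepKernel M π n) :=
  ⟨fun h => inferInstanceAs (IsProbabilityMeasure (M.p h.last (π n h)).toMeasure)⟩

/-- The conditional law of the infinite sequence of states, given that the history up to time `n`
is `h`, when the policy `π` acts in the MDP `M` (Ionescu-Tulcea). -/
def trajLaw (M : MDP S A) (π : Policy S A) {n : ℕ} (h : History S n) : Measure (ℕ → S) :=
  Kernel.traj (X := fun _ => S) (stepKernel M π) n h

/-- The history of length one that consists of the start state `s₁`. -/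
def startHistory (s₁ : S) : History S 0 := fun _ => s₁

/-- The law of the sequence of states generated by `π` in `M` from the start state `s₁`. -/
def processLaw (M : MDP S A) (π : Policy S A) (s₁ : S) : Measure (ℕ → S) :=
  trajLaw M π (startHistory s₁)

/-- The value of the policy `π` in `M` after the history `h`, i.e. the expected total discounted
reward from the current time on, where the current reward has weight one. -/
def value (M : MDP S A) (π : Policy S A) {n : ℕ} (h : History S n) : ℝ :=
  ∫ ω, ∑' k : ℕ, M.γ ^ k * M.r (ω (n + k)) ∂(trajLaw M π h)

/-- The optimal value in state `s`: the maximum over the (finitely many) stationary policies. -/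
def optValue (M : MDP S A) (s : S) : ℝ :=
  ⨆ f : S → A, value M (Policy.ofStationary f) (startHistory s)

/-- The time-steps at which `π` is not `ε`-optimal along the sequence of states `ω`. -/
def badSteps (M : MDP S A) (π : Policy S A) (ε : ℝ) (ω : ℕ → S) : Set ℕ :=
  {t | optValue M (ω t) - value M π (n := t) (fun i => ω i) > ε}

end Dynamics

/-! The constants. Here `nS` and `nA` are the numbers of states and of actions. -/

/-- The progression `z_i = 2 ^ i - 2`, used for `i ≥ 1`. -/
def z (i : ℕ) : ℕ := 2 ^ i - 2

/-- `Z(a) = {z_i : 1 ≤ i ≤ i₀}`, where `i₀` is the smallest `i ≥ 1` with `z_i ≥ a`. -/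
def Z (a : ℕ) : Finset ℕ := (Finset.Icc 1 (sInf {i : ℕ | 1 ≤ i ∧ a ≤ z i})).image z

/-- `ι_max`. -/
def iotaMax (nS : ℕ) (ε γ : ℝ) : ℕ :=
  ⌈1 / Real.log 2 * Real.log (8 * nS / (ε * (1 - γ) ^ 2))⌉₊

/-- `|𝒦 × ℐ|`, where `𝒦 = Z(|S|)` and `ℐ = {0, …, ι_max}`. -/
def cardKI (nS : ℕ) (ε γ : ℝ) : ℕ :=
  (Z nS).card * (Finset.range (iotaMax nS ε γ + 1)).card

/-- `β`. -/
def beta (γ : ℝ) : ℕ := ⌈1 / (2 * Real.log 2) * Real.log (1 / (1 - γ))⌉₊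

/-- `|𝒟|`, where `𝒟 = Z(β)`. -/
def cardD (γ : ℝ) : ℕ := (Z (beta γ)).card

/-- The horizon `H`. -/
def horizon (nS : ℕ) (ε γ : ℝ) : ℝ := 1 / (1 - γ) * Real.log (8 * nS / (ε * (1 - γ)))

/-- `U_max`. -/
def Umax (nS nA : ℕ) (ε γ : ℝ) : ℝ := (nS * nA : ℝ) * cardKI nS ε γ

/-- `δ₁`. -/
def delta1 (nS nA : ℕ) (ε δ γ : ℝ) : ℝ := δ / (2 * (nS * nA : ℝ) * Umax nS nA ε γ)

/-- `L₁`. -/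
def L1 (nS nA : ℕ) (ε δ γ : ℝ) : ℝ := Real.log (2 / delta1 nS nA ε δ γ)

/-- `m`; the exponent `2 + 2 / β` is real. -/
def mConst (nS nA : ℕ) (ε δ γ : ℝ) : ℝ :=
  20 * L1 nS nA ε δ γ * cardKI nS ε γ * (cardD γ : ℝ) ^ 2 /
    (ε ^ 2 * (1 - γ) ^ (2 + 2 / (beta γ : ℝ)))

/-- `N`. -/
def NConst (nS nA : ℕ) (ε δ γ : ℝ) : ℝ := 6 * (nS * nA : ℝ) * mConst nS nA ε δ γ

/-- `E_max`. -/
def Emax (nS nA : ℕ) (ε δ γ : ℝ) : ℝ := 4 * NConst nS nA ε δ γ * cardKI nS ε γ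

end PACMDP

end

/-! The policy is an optimistic learner. For each state-action pair it records the observed next
states, and it calls a distribution plausible if a Bernstein-type bound of width `W` holds on every
prefix of the record up to a cap `N`. It acts greedily for the pointwise supremum of all functions
that satisfy the Bellman inequality with, in every state, some action and some plausible
distribution. None of this involves the transition probabilities.

When the true probabilities are plausible, `optValue` is one of these functions, so the optimistic
value `Y` dominates the optimal value. It remains to bound `Y - Y'`, where `Y'` is the value of the
policy along the trajectory. Mark the first `K` bad times. If there are `K` of them before `T`, then
`Y - Y'` summed over the marked times is at least `ε K`; `Learner.sum_gap_lt` shows that it is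
smaller than `ε K` outside an exceptional event.

Summation by parts (`sum_mul_eq_discountedCount`) turns that sum into one-step differences of `Y -
Y'`, weighted by the discounted counts of the marks. Each difference is at most a Bellman error plus
a martingale increment. The Bellman error is, for any `η > 0`, a multiple of `η` times the variance
of the next optimistic value, plus `1 / η + G` times `|S| W / (number of samples)` up to constants,
plus a multiple of the drop of the optimistic value function; here `G = 1 / (1 - γ)`. The sample
terms add up to a logarithm per pair, and the drops telescope. The weights have total mass `G K`, so
bounding each variance by `G ^ 2` would give `G ^ 3 K`; the total variance argument
`discounted_variance_le` gives `O(G ^ 2 K)`, which is where a factor `G` is saved.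

All deviations are controlled by the Freedman-type inequality `processLaw_freedman`. For this the
learner uses its data with a delay of one step: the next optimistic value function is then known
before the next state is drawn.

With `x = logScale` and `L = L1`, about `12000 |S| ^ 2 |A| G ^ 3 L x ^ 2 / ε ^ 2` bad times are
possible. The sets `𝒦`, `ℐ`, `𝒟` enter only through their cardinalities, and these make the stated
bound larger (`sampleComplexity_le`). -/

namespace PACMDP

/-! ### Histories. -/

/-- The history of length `n + 1` seen along an infinite sequence of states. -/
abbrev hist {S : Type*} (ω : ℕ → S) (n : ℕ) : History S n := fun i => ω i

/-- Appending one state to a history. -/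
def History.snoc {S : Type*} {n : ℕ} (h : History S n) (s : S) : History S (n + 1) :=
  fun i => if hi : i.1 ≤ n then h ⟨i, Finset.mem_Iic.2 hi⟩ else s

@[simp]
lemma History.last_snoc {S : Type*} {n : ℕ} (h : History S n) (s : S) : (h.snoc s).last = s := by
  simp [History.last, History.snoc]

lemma hist_succ {S : Type*} (ω : ℕ → S) (n : ℕ) :
    hist ω (n + 1) = (hist ω n).snoc (ω (n + 1)) := by
  funext i
  by_cases hi : i.1 ≤ n
  · simp [History.snoc, hi]
  · have : i.1 = n + 1 := by have := Finset.mem_Iic.1 i.2; omega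
    rw [History.snoc, dif_neg hi, hist, this]

/-! ### Conditional laws of the trajectory. -/

section Law

variable {S A : Type*} [Fintype S] [MeasurableSpace S] [DiscreteMeasurableSpace S]
  (M : MDP S A) (π : Policy S A)

instance {n : ℕ} (h : History S n) : IsProbabilityMeasure (trajLaw M π h) := by
  unfold trajLaw; infer_instance

instance (s : S) : IsProbabilityMeasure (processLaw M π s) := by
  unfold processLaw; infer_instance

lemma ae_hist_eq {n : ℕ} (h : History S n) : ∀ᵐ ω ∂trajLaw M π h, hist ω n = h := by
  have h1 : (trajLaw M π h).map (Preorder.frestrictLe n) = Measure.dirac h := by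
    have := Kernel.traj_map_frestrictLe_apply (X := fun _ => S) (κ := stepKernel M π) n n h
    unfold trajLaw
    rw [this, Kernel.partialTraj_self, Kernel.id_apply]
  have h2 : ∀ᵐ x ∂((trajLaw M π h).map (Preorder.frestrictLe n)), x = h := by
    rw [h1]
    exact (ae_dirac_iff (measurableSet_singleton h)).2 rfl
  exact ae_of_ae_map (Preorder.measurable_frestrictLe n).aemeasurable h2

/-- The Ionescu-Tulcea kernels compose, and the one-step kernel is a finite sum over the next state.
Both the Bellman equation and the exponential supermartingale rest on this decomposition. -/
lemma trajLaw_eq_sum {n : ℕ} (h : History S n) :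
    trajLaw M π h = ∑ s, M.p h.last (π n h) s • trajLaw M π (h.snoc s) := by
  ext E hE
  have h1 := Kernel.traj_comp_partialTraj (X := fun _ => S) (κ := stepKernel M π) (Nat.le_succ n)
  unfold trajLaw
  have hg : Measurable fun x : History S (n + 1) =>
      Kernel.traj (X := fun _ => S) (stepKernel M π) (n + 1) x E := Kernel.measurable_coe _ hE
  have hI : Measurable (IicProdIoc (X := fun _ => S) n (n + 1)) := measurable_IicProdIoc
  have hS : Measurable (MeasurableEquiv.piSingleton (X := fun _ => S) n) :=
    (MeasurableEquiv.piSingleton (X := fun _ => S) n).measurable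
  have h2 : ∀ s, IicProdIoc (X := fun _ => S) n (n + 1)
      (h, MeasurableEquiv.piSingleton (X := fun _ => S) n s) = h.snoc s := by
    intro s
    funext i
    by_cases hi : i.1 ≤ n
    · simp [IicProdIoc, History.snoc, hi]
    · simp [IicProdIoc, History.snoc, hi, MeasurableEquiv.piSingleton]
  rw [← h1, Kernel.comp_apply' _ _ _ hE, Nat.succ_eq_add_one, Kernel.partialTraj_succ_self]
  refine (Kernel.lintegral_map _ hI h hg).trans ?_
  refine (Kernel.lintegral_id_prod (hg.comp hI) _ h).trans ?_
  refine (Kernel.lintegral_map _ hS h ((hg.comp hI).comp (by fun_prop))).trans ?_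
  simp only [Function.comp_apply, h2]
  rw [lintegral_fintype, Measure.finsetSum_apply]
  refine Finset.sum_congr rfl fun s _ => ?_
  rw [Measure.smul_apply, smul_eq_mul, mul_comm]
  congr 1
  exact PMF.toMeasure_apply_singleton _ _ (measurableSet_singleton s)

end Law


/-- Extending a history to an infinite sequence by repeating its last state. -/
def History.extend {S : Type*} {n : ℕ} (h : History S n) : ℕ → S :=
  fun i => h ⟨min i n, Finset.mem_Iic.2 (min_le_right i n)⟩

@[simp]
lemma hist_extend {S : Type*} {n : ℕ} (h : History S n) : hist h.extend n = h := by
  funext i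
  have := Finset.mem_Iic.1 i.2
  simp [History.extend, this]

/-- A sequence of functions of the trajectory is nonanticipating if its `u`-th member only depends
on the states up to time `u`. -/
def Nonanticipating {S α : Type*} (F : ℕ → (ℕ → S) → α) : Prop :=
  ∀ u ω ω', (∀ i ≤ u, ω i = ω' i) → F u ω = F u ω'

lemma eqOn_of_hist_eq {S : Type*} {ω ω' : ℕ → S} {u : ℕ} (h : hist ω u = hist ω' u) :
    ∀ i ≤ u, ω i = ω' i :=
  fun i hi => congrFun h ⟨i, Finset.mem_Iic.2 hi⟩

lemma hist_congr {S : Type*} {ω ω' : ℕ → S} {u : ℕ} (h : ∀ i ≤ u, ω i = ω' i) :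
    hist ω u = hist ω' u :=
  funext fun i => h i (Finset.mem_Iic.1 i.2)

/-- Such a function factors through the histories, which form a finite discrete space. -/
lemma Nonanticipating.measurable {S α : Type*} [Finite S] [MeasurableSpace S]
    [DiscreteMeasurableSpace S] [MeasurableSpace α] {F : ℕ → (ℕ → S) → α}
    (hF : Nonanticipating F) (u : ℕ) : Measurable (F u) := by
  have h1 : F u = (fun h : History S u => F u h.extend) ∘ Preorder.frestrictLe u := by
    funext ω
    exact hF u _ _ (eqOn_of_hist_eq (hist_extend (hist ω u)).symm)
  rw [h1]
  exact (Measurable.of_discrete).comp (Preorder.measurable_frestrictLe u)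

/-! ### Means and variances of finite distributions. -/

section Weights

variable {S : Type*} [Fintype S]

/-- The mean of `f` under the weights `p`. -/
def mean (p f : S → ℝ) : ℝ := ∑ s, p s * f s

/-- The variance of `f` under the weights `p`. -/
def var (p f : S → ℝ) : ℝ := ∑ s, p s * (f s - mean p f) ^ 2

lemma toReal_pmf_mem_stdSimplex (p : PMF S) : (fun s => (p s).toReal) ∈ stdSimplex ℝ S := by
  refine ⟨fun s => ENNReal.toReal_nonneg, ?_⟩
  rw [← ENNReal.toReal_sum fun s _ => p.apply_ne_top s]
  have := p.tsum_coe
  rw [tsum_fintype] at this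
  rw [this, ENNReal.toReal_one]

variable {p : S → ℝ}

lemma mean_mono (hp : p ∈ stdSimplex ℝ S) {f g : S → ℝ} (h : ∀ s, f s ≤ g s) :
    mean p f ≤ mean p g :=
  Finset.sum_le_sum fun s _ => mul_le_mul_of_nonneg_left (h s) (hp.1 s)

lemma mean_const (hp : p ∈ stdSimplex ℝ S) (c : ℝ) : mean p (fun _ => c) = c := by
  rw [mean, ← Finset.sum_mul, hp.2, one_mul]

lemma mean_nonneg (hp : p ∈ stdSimplex ℝ S) {f : S → ℝ} (h : ∀ s, 0 ≤ f s) : 0 ≤ mean p f :=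
  Finset.sum_nonneg fun s _ => mul_nonneg (hp.1 s) (h s)

lemma mean_le (hp : p ∈ stdSimplex ℝ S) {f : S → ℝ} {c : ℝ} (h : ∀ s, f s ≤ c) :
    mean p f ≤ c :=
  (mean_mono hp h).trans (mean_const hp c).le

lemma mean_sub (f g : S → ℝ) : mean p (fun s => f s - g s) = mean p f - mean p g := by
  simp [mean, mul_sub]

lemma mean_const_mul (c : ℝ) (f : S → ℝ) : mean p (fun s => c * f s) = c * mean p f := by
  simp only [mean, Finset.mul_sum]
  exact Finset.sum_congr rfl fun s _ => by ring

lemma var_nonneg (hp : p ∈ stdSimplex ℝ S) (f : S → ℝ) : 0 ≤ var p f :=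
  Finset.sum_nonneg fun s _ => mul_nonneg (hp.1 s) (sq_nonneg _)

lemma sum_mul_sub_sq (hp : p ∈ stdSimplex ℝ S) (f : S → ℝ) (c : ℝ) :
    ∑ s, p s * (f s - c) ^ 2 = var p f + (mean p f - c) ^ 2 := by
  have h1 : ∀ s, p s * (f s - c) ^ 2 = p s * (f s - mean p f) ^ 2 +
      (2 * (mean p f - c) * (p s * f s) - 2 * (mean p f - c) * mean p f * p s +
        (mean p f - c) ^ 2 * p s) := fun s => by ring
  rw [Finset.sum_congr rfl fun s _ => h1 s, Finset.sum_add_distrib, Finset.sum_add_distrib,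
    Finset.sum_sub_distrib, ← Finset.mul_sum, ← Finset.mul_sum, ← Finset.mul_sum, hp.2]
  change var p f + (2 * (mean p f - c) * mean p f - _ + _) = _
  ring

lemma var_le_sum_mul_sub_sq (hp : p ∈ stdSimplex ℝ S) (f : S → ℝ) (c : ℝ) :
    var p f ≤ ∑ s, p s * (f s - c) ^ 2 := by
  rw [sum_mul_sub_sq hp]
  nlinarith [sq_nonneg (mean p f - c)]

lemma mean_sq (hp : p ∈ stdSimplex ℝ S) (f : S → ℝ) :
    mean p (fun s => f s ^ 2) = var p f + mean p f ^ 2 := by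
  simpa [mean] using sum_mul_sub_sq hp f 0

lemma var_const_mul (c : ℝ) (f : S → ℝ) : var p (fun s => c * f s) = c ^ 2 * var p f := by
  rw [var, mean_const_mul, var, Finset.mul_sum]
  exact Finset.sum_congr rfl fun s _ => by ring

lemma var_sub_le (hp : p ∈ stdSimplex ℝ S) (f g : S → ℝ) :
    var p (fun s => f s - g s) ≤ 2 * var p f + 2 * var p g := by
  rw [var, mean_sub, var, var, Finset.mul_sum, Finset.mul_sum, ← Finset.sum_add_distrib]
  refine Finset.sum_le_sum fun s _ => ?_
  nlinarith [mul_nonneg (hp.1 s) (sq_nonneg ((f s - mean p f) + (g s - mean p g)))]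

/-- Squaring is `2 G`-Lipschitz on `[0, G]`, and the variance is at most the second moment about any
point, here the square of the mean. -/
lemma var_sq_le (hp : p ∈ stdSimplex ℝ S) {f : S → ℝ} {G : ℝ} (h0 : ∀ s, 0 ≤ f s)
    (hG : ∀ s, f s ≤ G) : var p (fun s => f s ^ 2) ≤ 4 * G ^ 2 * var p f := by
  refine (var_le_sum_mul_sub_sq hp _ (mean p f ^ 2)).trans ?_
  rw [var, Finset.mul_sum]
  refine Finset.sum_le_sum fun s _ => ?_
  have h1 := mean_nonneg hp h0
  have h2 := mean_le hp hG
  have h3 : (f s ^ 2 - mean p f ^ 2) ^ 2 = (f s + mean p f) ^ 2 * (f s - mean p f) ^ 2 := by ring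
  have h4 : (f s + mean p f) ^ 2 ≤ (2 * G) ^ 2 :=
    pow_le_pow_left₀ (add_nonneg (h0 s) h1) (by linarith [hG s]) 2
  rw [h3]
  nlinarith [mul_le_mul_of_nonneg_right h4
    (mul_nonneg (hp.1 s) (sq_nonneg (f s - mean p f)))]

/-- The exponential moment bound behind Bernstein's and Freedman's inequalities. -/
lemma sum_mul_exp_le_one (hp : p ∈ stdSimplex ℝ S) {f : S → ℝ}
    (h : ∀ s, f s - mean p f ≤ 1) :
    ∑ s, p s * Real.exp (f s - mean p f - var p f) ≤ 1 := by
  -- Below `-1` the quadratic exceeds `1`, so a one-sided bound on the deviation is enough.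
  have h1 : ∀ x : ℝ, x ≤ 1 → Real.exp x ≤ 1 + x + x ^ 2 := by
    intro x hx
    rcases le_or_gt (-1) x with h | h
    · have := Real.abs_exp_sub_one_sub_id_le (abs_le.2 ⟨h, hx⟩)
      linarith [(abs_le.1 this).2]
    · have h2 : Real.exp x ≤ 1 := Real.exp_le_one_iff.2 (by linarith)
      nlinarith
  have h2 : ∑ s, p s * Real.exp (f s - mean p f) ≤ 1 + var p f := by
    have : ∑ s, p s * (1 + (f s - mean p f) + (f s - mean p f) ^ 2) = 1 + var p f := by
      have h3 : ∀ s, p s * (1 + (f s - mean p f) + (f s - mean p f) ^ 2) =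
        p s + (p s * f s - mean p f * p s) + p s * (f s - mean p f) ^ 2 := fun s => by ring
      rw [Finset.sum_congr rfl fun s _ => h3 s, Finset.sum_add_distrib, Finset.sum_add_distrib,
        Finset.sum_sub_distrib, ← Finset.mul_sum, hp.2, mul_one]
      simp [mean, var]
    rw [← this]
    exact Finset.sum_le_sum fun s _ => mul_le_mul_of_nonneg_left (h1 _ (h s)) (hp.1 s)
  have h3 : ∑ s, p s * Real.exp (f s - mean p f - var p f) =
      Real.exp (-var p f) * ∑ s, p s * Real.exp (f s - mean p f) := by
    rw [Finset.mul_sum]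
    refine Finset.sum_congr rfl fun s _ => ?_
    rw [sub_eq_add_neg (f s - mean p f), Real.exp_add]
    ring
  rw [h3]
  calc _ ≤ Real.exp (-var p f) * Real.exp (var p f) :=
        mul_le_mul_of_nonneg_left (h2.trans (by linarith [Real.add_one_le_exp (var p f)]))
          (Real.exp_pos _).le
    _ = 1 := by rw [← Real.exp_add]; simp

end Weights

/-! ### Freedman's inequality along trajectories. -/

section Concentration

variable {S A : Type*}

/-- The conditional probabilities of the state at time `u + 1` given the states up to time `u`. -/
def prob (M : MDP S A) (π : Policy S A) (u : ℕ) (ω : ℕ → S) (s : S) : ℝ :=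
  (M.p (ω u) (π u (hist ω u)) s).toReal

lemma nonanticipating_prob (M : MDP S A) (π : Policy S A) : Nonanticipating (prob M π) := by
  intro u ω ω' h
  unfold prob
  rw [h u le_rfl, hist_congr h]

variable [Fintype S]

lemma prob_mem (M : MDP S A) (π : Policy S A) (u : ℕ) (ω : ℕ → S) :
    prob M π u ω ∈ stdSimplex ℝ S :=
  toReal_pmf_mem_stdSimplex _

variable [MeasurableSpace S] [DiscreteMeasurableSpace S]

/-- The increment looks one state ahead, so it is nonanticipating only at index `u + 1`; the
auxiliary family vanishes at earlier indices. -/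
lemma measurable_step {F : ℕ → (ℕ → S) → S → ℝ} (hF : Nonanticipating F) (u : ℕ) :
    Measurable fun ω : ℕ → S => F u ω (ω (u + 1)) := by
  have h1 : Nonanticipating fun v (ω : ℕ → S) => if u + 1 ≤ v then F u ω (ω (u + 1)) else 0 := by
    intro v ω ω' h
    by_cases hv : u + 1 ≤ v
    · simp only [hv, if_true]
      rw [hF u ω ω' fun i hi => h i (by omega), h (u + 1) hv]
    · simp only [hv, if_false]
  simpa using h1.measurable (u + 1)

/-- An exponential supermartingale. The induction removes the first step, whose factor is almost
surely constant once the history is extended by one state; this is why all starting histories are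
treated at once. -/
lemma lintegral_exp_sum_le_one (M : MDP S A) (π : Policy S A) {F : ℕ → (ℕ → S) → S → ℝ}
    (hF : Nonanticipating F)
    (h1 : ∀ u ω, ∑ s, prob M π u ω s * Real.exp (F u ω s) ≤ 1) (k : ℕ) :
    ∀ (n : ℕ) (h : History S n),
      ∫⁻ ω, ENNReal.ofReal (Real.exp (∑ i ∈ Finset.range k, F (n + i) ω (ω (n + i + 1))))
        ∂trajLaw M π h ≤ 1 := by
  induction k with
  | zero => intro n h; simp
  | succ k ih =>
    intro n h
    have h2 : ∀ s, ∫⁻ ω, ENNReal.ofReal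
        (Real.exp (∑ i ∈ Finset.range (k + 1), F (n + i) ω (ω (n + i + 1))))
        ∂trajLaw M π (h.snoc s) ≤ ENNReal.ofReal (Real.exp (F n h.extend s)) := by
      intro s
      have h3 : ∀ᵐ ω ∂trajLaw M π (h.snoc s), ENNReal.ofReal
          (Real.exp (∑ i ∈ Finset.range (k + 1), F (n + i) ω (ω (n + i + 1)))) =
          ENNReal.ofReal (Real.exp (F n h.extend s)) * ENNReal.ofReal
          (Real.exp (∑ i ∈ Finset.range k, F (n + 1 + i) ω (ω (n + 1 + i + 1)))) := by
        filter_upwards [ae_hist_eq M π (h.snoc s)] with ω hω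
        have h4 : ω (n + 1) = s := by
          have := congrArg History.last hω
          rwa [History.last_snoc] at this
        have h5 : F n ω = F n h.extend := by
          refine hF n _ _ (eqOn_of_hist_eq ?_)
          rw [hist_extend]
          funext i
          have := congrFun hω ⟨i.1, Finset.mem_Iic.2 ((Finset.mem_Iic.1 i.2).trans n.le_succ)⟩
          simpa [History.snoc, Finset.mem_Iic.1 i.2] using this
        rw [Finset.sum_range_succ', Real.exp_add, ENNReal.ofReal_mul (Real.exp_pos _).le, mul_comm]
        simp only [add_zero, h4, h5]
        congr 4
        funext i
        rw [show n + (i + 1) = n + 1 + i by ring]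
      rw [lintegral_congr_ae h3, lintegral_const_mul' _ _ ENNReal.ofReal_ne_top]
      exact (mul_le_mul_right (ih (n + 1) (h.snoc s)) _).trans (mul_one _).le
    rw [trajLaw_eq_sum, lintegral_finsetSum_measure]
    simp only [lintegral_smul_measure, smul_eq_mul]
    have h6 := h1 n h.extend
    calc _ ≤ ∑ s, M.p h.last (π n h) s * ENNReal.ofReal (Real.exp (F n h.extend s)) :=
          Finset.sum_le_sum fun s _ => mul_le_mul_right (h2 s) _
      _ = ENNReal.ofReal (∑ s, prob M π n h.extend s * Real.exp (F n h.extend s)) := by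
          rw [ENNReal.ofReal_sum_of_nonneg fun s _ =>
            mul_nonneg ((prob_mem M π n h.extend).1 s) (Real.exp_pos _).le]
          refine Finset.sum_congr rfl fun s _ => ?_
          rw [ENNReal.ofReal_mul ((prob_mem M π n h.extend).1 s), prob, hist_extend,
            ENNReal.ofReal_toReal (PMF.apply_ne_top _ _)]
          simp [History.extend, History.last]
      _ ≤ 1 := by simpa using ENNReal.ofReal_le_ofReal h6

/-- A Freedman-type concentration inequality along the trajectories of an MDP. -/
lemma processLaw_freedman (M : MDP S A) (π : Policy S A) (s₁ : S) {f : ℕ → (ℕ → S) → S → ℝ}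
    (hf : Nonanticipating f) {l : ℝ} (hl : 0 < l)
    (h1 : ∀ u ω s, l * (f u ω s - mean (prob M π u ω) (f u ω)) ≤ 1) (T : ℕ) (L : ℝ) :
    processLaw M π s₁ {ω | l * ∑ u ∈ Finset.range T, var (prob M π u ω) (f u ω) + L / l ≤
      ∑ u ∈ Finset.range T, (f u ω (ω (u + 1)) - mean (prob M π u ω) (f u ω))} ≤
      ENNReal.ofReal (Real.exp (-L)) := by
  -- Scaling by `l` makes the increments admissible for `sum_mul_exp_le_one`. The variance scales by
  -- `l ^ 2`; Markov's inequality at level `exp L`, divided by `l`, gives the stated form.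
  set F : ℕ → (ℕ → S) → S → ℝ := fun u ω s =>
    l * f u ω s - mean (prob M π u ω) (fun s => l * f u ω s) -
      var (prob M π u ω) (fun s => l * f u ω s) with hFdef
  have hF : Nonanticipating F := by
    intro u ω ω' h
    simp only [hFdef, hf u ω ω' h, nonanticipating_prob M π u ω ω' h]
  have h2 := lintegral_exp_sum_le_one M π hF (fun u ω => sum_mul_exp_le_one (prob_mem M π u ω)
    (fun s => by rw [mean_const_mul, ← mul_sub]; exact h1 u ω s)) T 0 (startHistory s₁)
  simp only [zero_add] at h2
  have hm : Measurable fun ω : ℕ → S => ENNReal.ofReal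
      (Real.exp (∑ i ∈ Finset.range T, F i ω (ω (i + 1)))) :=
    (Real.measurable_exp.comp (Finset.measurable_fun_sum _ fun u _ =>
      measurable_step hF u)).ennreal_ofReal
  have h3 := mul_meas_ge_le_lintegral (μ := processLaw M π s₁) hm
    (ENNReal.ofReal (Real.exp L))
  have h4 : {ω | l * ∑ u ∈ Finset.range T, var (prob M π u ω) (f u ω) + L / l ≤
      ∑ u ∈ Finset.range T, (f u ω (ω (u + 1)) - mean (prob M π u ω) (f u ω))} ⊆
      {ω : ℕ → S | ENNReal.ofReal (Real.exp L) ≤ ENNReal.ofReal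
        (Real.exp (∑ i ∈ Finset.range T, F i ω (ω (i + 1))))} := by
    intro ω hω
    simp only [Set.mem_ofPred_eq] at hω ⊢
    refine ENNReal.ofReal_le_ofReal (Real.exp_le_exp.2 ?_)
    have h5 : ∑ i ∈ Finset.range T, F i ω (ω (i + 1)) =
        l * ∑ u ∈ Finset.range T, (f u ω (ω (u + 1)) - mean (prob M π u ω) (f u ω)) -
        l * (l * ∑ u ∈ Finset.range T, var (prob M π u ω) (f u ω)) := by
      rw [Finset.mul_sum, Finset.mul_sum, Finset.mul_sum, ← Finset.sum_sub_distrib]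
      refine Finset.sum_congr rfl fun u _ => ?_
      simp only [hFdef, mean_const_mul, var_const_mul]
      ring
    rw [h5]
    have h6 := mul_le_mul_of_nonneg_left hω hl.le
    rw [mul_add, mul_div_cancel₀ _ hl.ne'] at h6
    linarith
  have h7 : ENNReal.ofReal (Real.exp L) * processLaw M π s₁ {ω | l * ∑ u ∈ Finset.range T,
      var (prob M π u ω) (f u ω) + L / l ≤
      ∑ u ∈ Finset.range T, (f u ω (ω (u + 1)) - mean (prob M π u ω) (f u ω))} ≤ 1 :=
    (mul_le_mul_right (measure_mono h4) _).trans (h3.trans h2)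
  rw [Real.exp_neg, ENNReal.ofReal_inv_of_pos (Real.exp_pos _)]
  rwa [ENNReal.le_inv_iff_mul_le, mul_comm]

end Concentration

/-! ### Values and Bellman relations. -/

section Value

variable {S A : Type*}

lemma MDP.discount_pos (M : MDP S A) : 0 < 1 - M.γ := by linarith [M.γ_mem.2]

/-- The discounted return from time `n` on. -/
noncomputable def discountedReturn (M : MDP S A) (n : ℕ) (ω : ℕ → S) : ℝ := ∑' k : ℕ, M.γ ^ k * M.r (ω (n + k))

lemma summable_return (M : MDP S A) (n : ℕ) (ω : ℕ → S) :
    Summable fun k : ℕ => M.γ ^ k * M.r (ω (n + k)) := by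
  refine Summable.of_nonneg_of_le
    (fun k => mul_nonneg (pow_nonneg M.γ_mem.1.le k) (M.r_mem _).1) (fun k => ?_)
    (summable_geometric_of_lt_one M.γ_mem.1.le M.γ_mem.2)
  exact mul_le_of_le_one_right (pow_nonneg M.γ_mem.1.le k) (M.r_mem _).2

lemma return_nonneg (M : MDP S A) (n : ℕ) (ω : ℕ → S) : 0 ≤ discountedReturn M n ω :=
  tsum_nonneg fun k => mul_nonneg (pow_nonneg M.γ_mem.1.le k) (M.r_mem _).1

lemma return_le (M : MDP S A) (n : ℕ) (ω : ℕ → S) : discountedReturn M n ω ≤ 1 / (1 - M.γ) := by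
  rw [one_div, ← tsum_geometric_of_lt_one M.γ_mem.1.le M.γ_mem.2]
  refine (summable_return M n ω).tsum_le_tsum (fun k => ?_)
    (summable_geometric_of_lt_one M.γ_mem.1.le M.γ_mem.2)
  exact mul_le_of_le_one_right (pow_nonneg M.γ_mem.1.le k) (M.r_mem _).2

lemma return_eq (M : MDP S A) (n : ℕ) (ω : ℕ → S) :
    discountedReturn M n ω = M.r (ω n) + M.γ * discountedReturn M (n + 1) ω := by
  unfold discountedReturn
  rw [(summable_return M n ω).tsum_eq_zero_add, ← tsum_mul_left]
  simp only [pow_zero, one_mul, add_zero]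
  congr 1
  refine tsum_congr fun k => ?_
  rw [pow_succ, show n + (k + 1) = n + 1 + k by ring]
  ring

variable [MeasurableSpace S] [DiscreteMeasurableSpace S]

lemma measurable_return (M : MDP S A) (n : ℕ) : Measurable (discountedReturn M n) := by
  refine measurable_of_tendsto_metrizable (f := fun m ω => ∑ k ∈ Finset.range m,
    M.γ ^ k * M.r (ω (n + k))) (fun m => ?_) ?_
  · exact Finset.measurable_fun_sum _ fun k _ =>
      ((Measurable.of_discrete (f := M.r)).comp (measurable_pi_apply (n + k))).const_mul _
  · exact tendsto_pi_nhds.2 fun ω => (summable_return M n ω).hasSum.tendsto_sum_nat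

lemma integrable_return (M : MDP S A) (n : ℕ) (μ : Measure (ℕ → S)) [IsFiniteMeasure μ] :
    Integrable (discountedReturn M n) μ := by
  refine Integrable.of_bound (measurable_return M n).aestronglyMeasurable (1 / (1 - M.γ))
    (ae_of_all _ fun ω => ?_)
  rw [Real.norm_of_nonneg (return_nonneg M n ω)]
  exact return_le M n ω

variable [Fintype S]

lemma value_nonneg (M : MDP S A) (π : Policy S A) {n : ℕ} (h : History S n) :
    0 ≤ value M π h :=
  integral_nonneg fun ω => return_nonneg M n ω

lemma value_le (M : MDP S A) (π : Policy S A) {n : ℕ} (h : History S n) :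
    value M π h ≤ 1 / (1 - M.γ) := by
  have := integral_mono (integrable_return M n (trajLaw M π h)) (integrable_const _)
    (return_le M n)
  simp only [integral_const, probReal_univ, one_smul] at this
  exact this

lemma value_eq (M : MDP S A) (π : Policy S A) {n : ℕ} (h : History S n) :
    value M π h = M.r h.last +
      M.γ * ∑ s, (M.p h.last (π n h) s).toReal * value M π (h.snoc s) := by
  have h1 : value M π h = ∫ ω, M.r h.last + M.γ * discountedReturn M (n + 1) ω ∂trajLaw M π h := by
    refine integral_congr_ae ?_
    filter_upwards [ae_hist_eq M π h] with ω hω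
    have h2 : ω n = h.last := by rw [← hω]; rfl
    rw [← h2]
    exact return_eq M n ω
  rw [h1, integral_add (integrable_const _) ((integrable_return M _ _).const_mul _),
    integral_const_mul]
  simp only [integral_const, probReal_univ, smul_eq_mul, one_mul]
  congr 2
  rw [trajLaw_eq_sum, integral_finsetSum_measure fun s _ =>
    (integrable_return M _ _).smul_measure (PMF.apply_ne_top _ _)]
  refine Finset.sum_congr rfl fun s _ => ?_
  rw [integral_smul_measure]
  rfl

/-- Equal last states give equal rewards and equal laws of the next state, so each step contracts
the difference by `γ`. -/
lemma abs_value_ofStationary_sub_le (M : MDP S A) (f : S → A) (k : ℕ) :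
    ∀ (n m : ℕ) (h : History S n) (h' : History S m), h.last = h'.last →
      |value M (Policy.ofStationary f) h - value M (Policy.ofStationary f) h'| ≤
        M.γ ^ k * (1 / (1 - M.γ)) := by
  induction k with
  | zero =>
    intro n m h h' _
    rw [pow_zero, one_mul, abs_le]
    constructor <;> linarith [value_nonneg M (Policy.ofStationary f) h,
      value_nonneg M (Policy.ofStationary f) h', value_le M (Policy.ofStationary f) h,
      value_le M (Policy.ofStationary f) h']
  | succ k ih =>
    intro n m h h' hh
    rw [value_eq M _ h, value_eq M _ h', hh]
    simp only [Policy.ofStationary, hh]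
    rw [add_sub_add_left_eq_sub, ← mul_sub, ← Finset.sum_sub_distrib, abs_mul,
      abs_of_pos M.γ_mem.1, pow_succ, mul_comm _ M.γ, mul_assoc]
    refine mul_le_mul_of_nonneg_left ?_ M.γ_mem.1.le
    refine (Finset.abs_sum_le_sum_abs _ _).trans ?_
    have hp := toReal_pmf_mem_stdSimplex (M.p h'.last (f h'.last))
    refine le_trans ?_ (mean_const hp (M.γ ^ k * (1 / (1 - M.γ)))).le
    refine Finset.sum_le_sum fun s _ => ?_
    rw [← mul_sub, abs_mul, abs_of_nonneg (hp.1 s)]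
    exact mul_le_mul_of_nonneg_left (ih _ _ _ _ (by simp)) (hp.1 s)

lemma value_ofStationary_congr (M : MDP S A) (f : S → A) {n m : ℕ} (h : History S n)
    (h' : History S m) (hh : h.last = h'.last) :
    value M (Policy.ofStationary f) h = value M (Policy.ofStationary f) h' := by
  have h1 : Filter.Tendsto (fun k : ℕ => M.γ ^ k * (1 / (1 - M.γ))) Filter.atTop (nhds 0) := by
    simpa using (tendsto_pow_atTop_nhds_zero_of_lt_one M.γ_mem.1.le M.γ_mem.2).mul_const
      (1 / (1 - M.γ))
  have h2 := ge_of_tendsto' h1 fun k => abs_value_ofStationary_sub_le M f k n m h h' hh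
  exact sub_eq_zero.1 (abs_nonpos_iff.1 h2)

variable [Fintype A]

lemma le_optValue (M : MDP S A) (f : S → A) (s : S) :
    value M (Policy.ofStationary f) (startHistory s) ≤ optValue M s := by
  classical
  exact le_ciSup (f := fun f : S → A => value M (Policy.ofStationary f) (startHistory s))
    (Set.finite_range _).bddAbove f

variable [Nonempty A]

lemma exists_optValue_eq (M : MDP S A) (s : S) :
    ∃ f : S → A, value M (Policy.ofStationary f) (startHistory s) = optValue M s := by
  classical
  exact exists_eq_ciSup_of_finite

lemma optValue_nonneg (M : MDP S A) (s : S) : 0 ≤ optValue M s := by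
  obtain ⟨f, hf⟩ := exists_optValue_eq M s
  exact hf ▸ value_nonneg M _ _

lemma optValue_le (M : MDP S A) (s : S) : optValue M s ≤ 1 / (1 - M.γ) := by
  obtain ⟨f, hf⟩ := exists_optValue_eq M s
  exact hf ▸ value_le M _ _

/-- Only this half of the optimality equation is needed. A stationary policy that is best at `s`
supplies the action, and its continuation is worth at most `optValue`. -/
lemma exists_optValue_le (M : MDP S A) (s : S) :
    ∃ a, optValue M s ≤ M.r s + M.γ * mean (fun s' => (M.p s a s').toReal) (optValue M) := by
  obtain ⟨f, hf⟩ := exists_optValue_eq M s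
  refine ⟨f s, ?_⟩
  rw [← hf, value_eq]
  refine add_le_add le_rfl (mul_le_mul_of_nonneg_left ?_ M.γ_mem.1.le)
  refine Finset.sum_le_sum fun s' _ => mul_le_mul_of_nonneg_left ?_ ENNReal.toReal_nonneg
  rw [value_ofStationary_congr M f ((startHistory s).snoc s') (startHistory s')
    (History.last_snoc _ _)]
  exact le_optValue M f s'

/-- For a single state, `log |S| = 0` and no bad time is allowed. -/
lemma optValue_eq_value_of_subsingleton [Subsingleton S] (M : MDP S A) (π : Policy S A) (s : S)
    {n : ℕ} (h : History S n) : optValue M s = value M π h := by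
  have h1 : ∀ (π : Policy S A) {n : ℕ} (h : History S n),
      value M π h = ∑' k : ℕ, M.γ ^ k * M.r s := by
    intro π n h
    unfold value
    simp_rw [Subsingleton.elim _ s]
    simp
  obtain ⟨f, hf⟩ := exists_optValue_eq M s
  rw [← hf, h1, h1]

end Value

/-! ### The optimistic learner and its data. -/

/-- The parameters of the optimistic learner: rewards, discount factor, the width of the
confidence sets, and the number of samples of each state-action pair that are used. -/
structure Learner (S : Type*) where
  r : S → ℝ
  γ : ℝ
  width : ℝ
  cap : ℕ

section Estimates

open scoped Classical in
/-- The transition probabilities that are compatible with the first samples in the list `l`. -/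
def plausible {S : Type*} [Fintype S] (W : ℝ) (N : ℕ) (l : List S) : Set (S → ℝ) :=
  {q | q ∈ stdSimplex ℝ S ∧ ∀ n ≤ l.length, n ≤ N → ∀ s,
    |n * q s - ((l.take n).count s : ℝ)| ≤ 2 * √(n * q s * W) + 2 * W}

variable {S A : Type*} [Fintype S]

/-- Constraints on all prefixes, not only on the full record, make the plausible sets shrink as data
arrive. Hence the optimistic values decrease in time. -/
lemma plausible_anti {W : ℝ} {N : ℕ} {l l' : List S} (h : l <+: l') :
    plausible W N l' ⊆ plausible W N l := by
  rintro q ⟨hq, hq'⟩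
  obtain ⟨t, rfl⟩ := h
  refine ⟨hq, fun n hn hN s => ?_⟩
  have := hq' n (hn.trans (List.prefix_append l t).length_le) hN s
  rwa [List.take_append_of_le_length hn] at this

/-- Samples of the next state for all state-action pairs, in their order of arrival. -/
abbrev Samples (S A : Type*) : Type _ := S → A → List S

namespace Learner

variable (Λ : Learner S)

/-- The functions that solve the optimistic Bellman inequality. -/
def subsolutions (D : Samples S A) : Set (S → ℝ) :=
  {v | (∀ s, 0 ≤ v s ∧ v s ≤ 1 / (1 - Λ.γ)) ∧ ∀ s, ∃ a, ∃ q ∈ plausible Λ.width Λ.cap (D s a),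
    v s ≤ Λ.r s + Λ.γ * mean q v}

/-- The optimistic value function. -/
noncomputable def optimisticValue (D : Samples S A) (s : S) : ℝ :=
  sSup ((fun v => v s) '' Λ.subsolutions D)

/-- The optimistic value of the next state. -/
noncomputable def optimisticNext (D : Samples S A) (s : S) (a : A) : ℝ :=
  sSup ((fun q => mean q (Λ.optimisticValue D)) '' plausible Λ.width Λ.cap (D s a))

lemma bddAbove_subsolutions (D : Samples S A) (s : S) :
    BddAbove ((fun v => v s) '' Λ.subsolutions D) := by
  refine ⟨1 / (1 - Λ.γ), ?_⟩
  rintro _ ⟨v, hv, rfl⟩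
  exact (hv.1 s).2

lemma optimisticValue_nonneg (D : Samples S A) (s : S) : 0 ≤ Λ.optimisticValue D s := by
  refine Real.sSup_nonneg ?_
  rintro _ ⟨v, hv, rfl⟩
  exact (hv.1 s).1

lemma optimisticValue_le (hγ : Λ.γ < 1) (D : Samples S A) (s : S) :
    Λ.optimisticValue D s ≤ 1 / (1 - Λ.γ) := by
  refine Real.sSup_le ?_ (one_div_nonneg.2 (by linarith))
  rintro _ ⟨v, hv, rfl⟩
  exact (hv.1 s).2

lemma le_optimisticValue {D : Samples S A} {v : S → ℝ} (hv : v ∈ Λ.subsolutions D) (s : S) :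
    v s ≤ Λ.optimisticValue D s :=
  le_csSup (Λ.bddAbove_subsolutions D s) ⟨v, hv, rfl⟩

lemma optimisticValue_anti {D D' : Samples S A} (h : ∀ s a, D s a <+: D' s a) (s : S) :
    Λ.optimisticValue D' s ≤ Λ.optimisticValue D s := by
  -- There may be no subsolution left for `D'`; the supremum is then `0`, which is why nonnegativity
  -- of the other side is supplied.
  refine Real.sSup_le ?_ (Λ.optimisticValue_nonneg D s)
  rintro _ ⟨v, hv, rfl⟩
  refine Λ.le_optimisticValue (v := v) ⟨hv.1, fun s => ?_⟩ s
  obtain ⟨a, q, hq, hle⟩ := hv.2 s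
  exact ⟨a, q, plausible_anti (h s a) hq, hle⟩

lemma mean_le_optimisticNext (hγ : Λ.γ < 1) {D : Samples S A} {s : S} {a : A} {q : S → ℝ}
    (hq : q ∈ plausible Λ.width Λ.cap (D s a)) :
    mean q (Λ.optimisticValue D) ≤ Λ.optimisticNext D s a := by
  refine le_csSup ⟨1 / (1 - Λ.γ), ?_⟩ ⟨q, hq, rfl⟩
  rintro _ ⟨q', hq', rfl⟩
  exact mean_le hq'.1 (Λ.optimisticValue_le hγ D)

variable [Finite A] [Nonempty A]

/-- The optimistic action. -/
noncomputable def act (D : Samples S A) (s : S) : A :=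
  (Finite.exists_max (Λ.optimisticNext D s)).choose

lemma optimisticNext_le_act (D : Samples S A) (s : S) (a : A) :
    Λ.optimisticNext D s a ≤ Λ.optimisticNext D s (Λ.act D s) :=
  (Finite.exists_max (Λ.optimisticNext D s)).choose_spec a

/-- The Bellman inequality for the greedy action. An upper bound `c` stands in for a maximising
distribution, so no supremum has to be attained. -/
lemma optimisticValue_le_of_forall (hγ0 : 0 ≤ Λ.γ) (hγ : Λ.γ < 1) {D : Samples S A} {s : S} {c : ℝ}
    (hv : (Λ.subsolutions D).Nonempty)
    (hp : (plausible Λ.width Λ.cap (D s (Λ.act D s))).Nonempty)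
    (hc : ∀ q ∈ plausible Λ.width Λ.cap (D s (Λ.act D s)), mean q (Λ.optimisticValue D) ≤ c) :
    Λ.optimisticValue D s ≤ Λ.r s + Λ.γ * c := by
  refine csSup_le (hv.image _) ?_
  rintro _ ⟨v, hv, rfl⟩
  obtain ⟨a, q, hq, hle⟩ := hv.2 s
  refine hle.trans (add_le_add le_rfl (mul_le_mul_of_nonneg_left ?_ hγ0))
  refine (mean_mono hq.1 fun s => Λ.le_optimisticValue hv s).trans ?_
  refine (Λ.mean_le_optimisticNext hγ hq).trans ((Λ.optimisticNext_le_act D s a).trans ?_)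
  refine csSup_le (hp.image _) ?_
  rintro _ ⟨q', hq', rfl⟩
  exact hc q' hq'

open scoped Classical in
/-- The samples that the learner uses at time `u` (those of the transitions before time `u - 1`),
and all the samples that are available at time `u`. -/
noncomputable def data (ω : ℕ → S) : ℕ → Samples S A × Samples S A
  | 0 => (fun _ _ => [], fun _ _ => [])
  | u + 1 => ((data ω u).2, fun s a =>
      if s = ω u ∧ a = Λ.act (data ω u).1 (ω u) then (data ω u).2 s a ++ [ω (u + 1)]
      else (data ω u).2 s a)

/-- The samples that the learner uses at time `u`. -/
noncomputable def used (ω : ℕ → S) (u : ℕ) : Samples S A := (Λ.data ω u).1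

/-- The samples that are available at time `u`. -/
noncomputable def available (ω : ℕ → S) (u : ℕ) : Samples S A := (Λ.data ω u).2

/-- The action of the learner at time `u`. -/
noncomputable def action (ω : ℕ → S) (u : ℕ) : A := Λ.act (Λ.used ω u) (ω u)

/-- The policy of the learner. -/
noncomputable def policy : Policy S A := fun n h => Λ.action h.extend n

lemma data_congr {u : ℕ} {ω ω' : ℕ → S} (h : ∀ i ≤ u, ω i = ω' i) :
    (Λ.data ω u : Samples S A × Samples S A) = Λ.data ω' u := by
  induction u with
  | zero => rfl
  | succ u ih =>
    have ih := ih fun i hi => h i (hi.trans u.le_succ)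
    rw [data, data, ih, h u u.le_succ, h (u + 1) le_rfl]

lemma nonanticipating_used :
    Nonanticipating (fun u ω => (Λ.used ω u : Samples S A)) :=
  fun _ _ _ h => congrArg Prod.fst (Λ.data_congr h)

lemma nonanticipating_available :
    Nonanticipating (fun u ω => (Λ.available ω u : Samples S A)) :=
  fun _ _ _ h => congrArg Prod.snd (Λ.data_congr h)

lemma nonanticipating_action : Nonanticipating (fun u ω => (Λ.action ω u : A)) := by
  intro u ω ω' h
  have h1 := Λ.nonanticipating_used (A := A) u ω ω' h
  simp only at h1
  simp only [action, h1, h u le_rfl]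

lemma policy_hist (ω : ℕ → S) (u : ℕ) : (Λ.policy : Policy S A) u (hist ω u) = Λ.action ω u :=
  Λ.nonanticipating_action u _ _ (eqOn_of_hist_eq (hist_extend (hist ω u)))

variable (ω : ℕ → S)

/-- This is the delay: the data used at time `u + 1` do not depend on the state drawn at that time.
-/
lemma used_succ (u : ℕ) : (Λ.used ω (u + 1) : Samples S A) = Λ.available ω u := rfl

open scoped Classical in
lemma available_succ (u : ℕ) (s : S) (a : A) : Λ.available ω (u + 1) s a =
    if s = ω u ∧ a = Λ.action ω u then Λ.available ω u s a ++ [ω (u + 1)]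
    else Λ.available ω u s a := rfl

lemma available_prefix_succ (u : ℕ) (s : S) (a : A) :
    Λ.available ω u s a <+: Λ.available ω (u + 1) s a := by
  rw [available_succ]
  split_ifs
  · exact List.prefix_append _ _
  · exact List.prefix_rfl

lemma available_prefix {u v : ℕ} (h : u ≤ v) (s : S) (a : A) :
    Λ.available ω u s a <+: Λ.available ω v s a := by
  induction v, h using Nat.le_induction with
  | base => exact List.prefix_rfl
  | succ v _ ih => exact ih.trans (Λ.available_prefix_succ ω v s a)

lemma used_prefix_available (u : ℕ) (s : S) (a : A) :
    Λ.used ω u s a <+: Λ.available ω u s a := by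
  cases u with
  | zero => exact List.prefix_rfl
  | succ u => exact Λ.available_prefix_succ ω u s a

lemma used_prefix_succ (u : ℕ) (s : S) (a : A) :
    Λ.used ω u s a <+: Λ.used ω (u + 1) s a :=
  Λ.used_prefix_available ω u s a

/-- The price of the delay is at most one unused sample. -/
lemma length_available_le (u : ℕ) (s : S) (a : A) :
    (Λ.available ω u s a).length ≤ (Λ.used ω u s a).length + 1 := by
  cases u with
  | zero => exact Nat.zero_le _
  | succ u =>
    rw [available_succ, used_succ]
    split_ifs <;> simp

-- Written as a sum over time, the count has the increments to which Freedman's inequality applies.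
open scoped Classical in
lemma count_take_available (n T : ℕ) (s : S) (a : A) (s' : S) :
    (((Λ.available ω T s a).take n).count s' : ℝ) = ∑ u ∈ Finset.range T,
      if s = ω u ∧ a = Λ.action ω u ∧ (Λ.available ω u s a).length < n then
        (if ω (u + 1) = s' then (1 : ℝ) else 0) else 0 := by
  induction T with
  | zero => simp [available, data]
  | succ T ih =>
    rw [Finset.sum_range_succ, ← ih, available_succ]
    by_cases h : s = ω T ∧ a = Λ.action ω T
    · rw [if_pos h]
      by_cases hn : (Λ.available ω T s a).length < n
      · rw [if_pos ⟨h.1, h.2, hn⟩, List.take_append, List.take_of_length_le hn.le,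
          List.take_of_length_le (by simp; omega), List.count_append]
        by_cases h' : ω (T + 1) = s' <;> simp [h']
      · rw [if_neg (fun h' => hn h'.2.2), List.take_append_of_le_length (by omega), add_zero]
    · rw [if_neg h, if_neg (fun h' => h ⟨h'.1, h'.2.1⟩), add_zero]

-- The record grows by one at each visit, so the lengths met at the visits are `0, 1, 2, …`, once
-- each. Sums along the trajectory become sums over sample sizes.
open scoped Classical in
lemma sum_length_available (f : ℕ → ℝ) (T : ℕ) (s : S) (a : A) :
    (∑ u ∈ Finset.range T, if s = ω u ∧ a = Λ.action ω u then f (Λ.available ω u s a).length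
      else 0) = ∑ j ∈ Finset.range (Λ.available ω T s a).length, f j := by
  induction T with
  | zero => simp [available, data]
  | succ T ih =>
    rw [Finset.sum_range_succ, ih, available_succ]
    by_cases h : s = ω T ∧ a = Λ.action ω T
    · rw [if_pos h, if_pos h, List.length_append, List.length_singleton, Finset.sum_range_succ]
    · rw [if_neg h, if_neg h, add_zero]

end Learner
end Estimates

/-! ### Distance between plausible distributions. -/

section Deviation

variable {S : Type*} [Fintype S]

/-- The squared width of a confidence set that is based on `n` samples. -/
noncomputable def sqWidth (W : ℝ) (n : ℕ) : ℝ := if (n : ℝ) < W then 1 else W / n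

lemma sqWidth_nonneg {W : ℝ} (hW : 0 < W) (n : ℕ) : 0 ≤ sqWidth W n := by
  unfold sqWidth
  split_ifs
  · exact zero_le_one
  · positivity

lemma sqWidth_le_one {W : ℝ} (hW : 0 < W) (n : ℕ) : sqWidth W n ≤ 1 := by
  unfold sqWidth
  split_ifs with h
  · exact le_rfl
  · exact (div_le_one (hW.trans_le (not_lt.1 h))).2 (not_lt.1 h)

lemma sqWidth_anti {W : ℝ} (hW : 0 < W) : Antitone (sqWidth W) := by
  intro m n hmn
  have hmn' : (m : ℝ) ≤ n := by exact_mod_cast hmn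
  by_cases h : (m : ℝ) < W
  · rw [show sqWidth W m = 1 from if_pos h]
    exact sqWidth_le_one hW n
  · have hn : ¬(n : ℝ) < W := fun h' => h (hmn'.trans_lt h')
    rw [sqWidth, sqWidth, if_neg h, if_neg hn]
    exact div_le_div_of_nonneg_left hW.le (hW.trans_le (not_lt.1 h)) hmn'

/-- Used with `x = √(n q)`, `y = √(n p)`, `w = √W`, to remove `q` from the right-hand side. If `x >
y + 4 w`, the hypothesis forces `x + y ≤ 2 w` or `w = 0`, a contradiction. -/
lemma abs_sq_sub_sq_le {x y w : ℝ} (hy : 0 ≤ y) (hw : 0 ≤ w)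
    (h : |x ^ 2 - y ^ 2| ≤ 2 * w * (x + y) + 4 * w ^ 2) :
    |x ^ 2 - y ^ 2| ≤ 4 * w * y + 12 * w ^ 2 := by
  rcases le_or_gt x (y + 4 * w) with h1 | h1
  · nlinarith
  · exfalso
    have h2 := (abs_le.1 h).2
    rcases hw.eq_or_lt with rfl | hw
    · nlinarith
    · have h3 : 4 * w * (x + y) ≤ (x - y) * (x + y) :=
        mul_le_mul_of_nonneg_right (by linarith) (by linarith)
      nlinarith [mul_pos hw hw]

lemma abs_sub_le_of_mem_plausible {W : ℝ} (hW : 0 < W) {N : ℕ} {l : List S} {p q : S → ℝ}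
    (hp : p ∈ plausible W N l) (hq : q ∈ plausible W N l)
    (hn : W ≤ (min l.length N : ℕ)) (s : S) :
    |q s - p s| ≤ 4 * (√(p s) * √(W / (min l.length N : ℕ))) + 12 * (W / (min l.length N : ℕ)) := by
  set n := min l.length N
  have hn0 : (0 : ℝ) < n := hW.trans_le hn
  have h1 := hp.2 n (min_le_left _ _) (min_le_right _ _) s
  have h2 := hq.2 n (min_le_left _ _) (min_le_right _ _) s
  have hps := hp.1.1 s
  have hqs := hq.1.1 s
  have e1 : √(n * p s * W) = √W * √(n * p s) := by
    rw [mul_comm, Real.sqrt_mul hW.le]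
  have e2 : √(n * q s * W) = √W * √(n * q s) := by
    rw [mul_comm, Real.sqrt_mul hW.le]
  have f1 : √(n * p s) ^ 2 = n * p s := Real.sq_sqrt (by positivity)
  have f2 : √(n * q s) ^ 2 = n * q s := Real.sq_sqrt (by positivity)
  have f3 : √W ^ 2 = W := Real.sq_sqrt hW.le
  have h3 : |√(n * q s) ^ 2 - √(n * p s) ^ 2| ≤
      2 * √W * (√(n * q s) + √(n * p s)) + 4 * √W ^ 2 := by
    rw [f1, f2, f3]
    rw [e1] at h1
    rw [e2] at h2
    rw [abs_le] at *
    constructor <;> linarith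
  have h4 := abs_sq_sub_sq_le (Real.sqrt_nonneg _) (Real.sqrt_nonneg _) h3
  rw [f1, f2, f3, ← mul_sub, abs_mul, abs_of_pos hn0] at h4
  have h5 : √W * √(n * p s) = n * (√(p s) * √(W / n)) := by
    rw [← Real.sqrt_mul hW.le, ← Real.sqrt_mul hps]
    nth_rewrite 2 [← Real.sqrt_sq hn0.le]
    rw [← Real.sqrt_mul (sq_nonneg _)]
    congr 1
    field_simp
  have h6 : W = n * (W / n) := by field_simp
  rw [mul_assoc, h5] at h4
  nth_rewrite 2 [h6] at h4
  refine le_of_mul_le_mul_left ?_ hn0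
  linarith

/-- Both weights sum to one, so `f` may be centred at its mean. The statewise bound `4 √(p b) + 12
b` on `|q - p|` and the AM-GM inequality with parameter `η` separate the variance from `b`; adding
`b` over all states gives the factor `|S|`, whatever the support. With fewer than `W` samples the
trivial bound `G` suffices. -/
lemma mean_sub_mean_le_of_mem_plausible {W : ℝ} (hW : 0 < W) {N : ℕ} {l : List S} {p q : S → ℝ}
    (hp : p ∈ plausible W N l) (hq : q ∈ plausible W N l) {f : S → ℝ} {G : ℝ}
    (h0 : ∀ s, 0 ≤ f s) (hG : ∀ s, f s ≤ G) {γ η : ℝ} (hγ0 : 0 ≤ γ) (hγ1 : γ ≤ 1) (hη : 0 < η) :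
    γ * (mean q f - mean p f) ≤ η * (γ ^ 2 * var p f) +
      (4 / η + 12 * G) * (Fintype.card S * sqWidth W (min l.length N)) := by
  have hS : (1 : ℝ) ≤ Fintype.card S := by
    have : Nonempty S := by
      by_contra h
      rw [not_nonempty_iff] at h
      simpa using hp.1.2
    exact_mod_cast Fintype.card_pos
  have hGn : 0 ≤ G := (mean_nonneg hp.1 h0).trans (mean_le hp.1 hG)
  have hv := var_nonneg hp.1 f
  by_cases hn : ((min l.length N : ℕ) : ℝ) < W
  · rw [sqWidth, if_pos hn, mul_one]
    have h1 : mean q f - mean p f ≤ G := by linarith [mean_le hq.1 hG, mean_nonneg hp.1 h0]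
    have h2 : γ * (mean q f - mean p f) ≤ G :=
      (mul_le_mul_of_nonneg_left h1 hγ0).trans (mul_le_of_le_one_left hGn hγ1)
    have h3 : 0 ≤ 4 / η * Fintype.card S := by positivity
    have h4 : 0 ≤ η * (γ ^ 2 * var p f) := by positivity
    nlinarith [mul_le_mul_of_nonneg_left hS hGn]
  · rw [sqWidth, if_neg hn]
    set b := W / (min l.length N : ℕ) with hb
    have hb0 : 0 ≤ b := by positivity
    have h1 : mean q f - mean p f = ∑ s, (q s - p s) * (f s - mean p f) := by
      have : ∀ s, (q s - p s) * (f s - mean p f) =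
        (q s * f s - p s * f s) - mean p f * (q s - p s) := fun s => by ring
      rw [Finset.sum_congr rfl fun s _ => this s, Finset.sum_sub_distrib, ← Finset.mul_sum,
        Finset.sum_sub_distrib, Finset.sum_sub_distrib, hp.1.2, hq.1.2]
      simp [mean]
    have h2 : (4 / η + 12 * G) * (Fintype.card S * b) = ∑ _s : S, (4 / η + 12 * G) * b := by
      rw [Finset.sum_const, Finset.card_univ, nsmul_eq_mul]
      ring
    have h3 : η * (γ ^ 2 * var p f) = ∑ s, η * (γ ^ 2 * (p s * (f s - mean p f) ^ 2)) := by
      rw [var, Finset.mul_sum, Finset.mul_sum]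
    rw [h1, h2, h3, ← Finset.sum_add_distrib, Finset.mul_sum]
    refine Finset.sum_le_sum fun s _ => ?_
    have h4 := abs_sub_le_of_mem_plausible hW hp hq (not_lt.1 hn) s
    rw [← hb] at h4
    set D := |f s - mean p f| with hD
    have hD0 : 0 ≤ D := abs_nonneg _
    have hDG : D ≤ G := by
      rw [hD, abs_le]
      constructor <;> linarith [h0 s, hG s, mean_le hp.1 hG, mean_nonneg hp.1 h0]
    have h5 : (q s - p s) * (f s - mean p f) ≤ (4 * (√(p s) * √b) + 12 * b) * D := by
      refine (le_abs_self _).trans ?_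
      rw [abs_mul]
      exact mul_le_mul_of_nonneg_right h4 hD0
    have h6 : γ * ((q s - p s) * (f s - mean p f)) ≤
        4 * ((γ * √(p s) * D) * √b) + 12 * (b * G) := by
      calc _ ≤ γ * ((4 * (√(p s) * √b) + 12 * b) * D) := mul_le_mul_of_nonneg_left h5 hγ0
        _ = 4 * ((γ * √(p s) * D) * √b) + γ * (12 * (b * D)) := by ring
        _ ≤ _ := by
          have : b * D ≤ b * G := mul_le_mul_of_nonneg_left hDG hb0
          have h7 : γ * (12 * (b * D)) ≤ 12 * (b * D) := mul_le_of_le_one_left (by positivity) hγ1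
          linarith
    have h8 : (γ * √(p s) * D) ^ 2 = γ ^ 2 * (p s * (f s - mean p f) ^ 2) := by
      rw [mul_pow, mul_pow, Real.sq_sqrt (hp.1.1 s), hD, sq_abs]
      ring
    have h9 : √b ^ 2 = b := Real.sq_sqrt hb0
    have h10 : 4 * ((γ * √(p s) * D) * √b) ≤
        η * (γ * √(p s) * D) ^ 2 + 4 / η * √b ^ 2 := by
      have : η * (γ * √(p s) * D) ^ 2 + 4 / η * √b ^ 2 - 4 * ((γ * √(p s) * D) * √b) =
          (η * (γ * √(p s) * D) - 2 * √b) ^ 2 / η := by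
        field_simp
        ring
      have h11 : 0 ≤ (η * (γ * √(p s) * D) - 2 * √b) ^ 2 / η := by positivity
      linarith
    rw [h8, h9] at h10
    linarith

lemma sum_sqWidth_le_of_le {W : ℝ} (hW : 0 < W) (N : ℕ) :
    ∑ j ∈ Finset.range N, sqWidth W j ≤ N := by
  calc _ ≤ ∑ _j ∈ Finset.range N, (1 : ℝ) := Finset.sum_le_sum fun j _ => sqWidth_le_one hW j
    _ = N := by simp

/-- The first `⌈W⌉ + 1` terms are at most one each, and the others form a harmonic sum that is
compared with the logarithm. -/
lemma sum_sqWidth_le {W : ℝ} (hW : 0 < W) {N : ℕ} (hN : W ≤ N) :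
    ∑ j ∈ Finset.range (N + 1), sqWidth W j ≤ W + 2 + W * Real.log (N / W) := by
  obtain ⟨k, rfl⟩ := Nat.exists_eq_add_of_le (Nat.ceil_le.2 hN)
  clear hN
  have h0 : (⌈W⌉₊ : ℝ) < W + 1 := Nat.ceil_lt_add_one hW.le
  have h1 : W ≤ (⌈W⌉₊ : ℝ) := Nat.le_ceil W
  induction k with
  | zero =>
    refine (sum_sqWidth_le_of_le hW _).trans ?_
    have : 0 ≤ Real.log ((⌈W⌉₊ + 0 : ℕ) / W) :=
      Real.log_nonneg ((one_le_div hW).2 (by simpa using h1))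
    push_cast
    push_cast at this
    nlinarith
  | succ k ih =>
    rw [← add_assoc, Finset.sum_range_succ]
    set n := ⌈W⌉₊ + k with hn
    have hn1 : W ≤ (n : ℝ) := by rw [hn]; push_cast; linarith [(Nat.cast_nonneg k : (0 : ℝ) ≤ k)]
    have hn0 : (0 : ℝ) < n := hW.trans_le hn1
    have h2 : sqWidth W (n + 1) = W / (n + 1) := by
      rw [sqWidth, if_neg (by push_cast; linarith)]
      push_cast
      rfl
    have h3 : 1 / ((n : ℝ) + 1) ≤ Real.log ((n + 1) / W) - Real.log (n / W) := by
      rw [← Real.log_div (by positivity) (by positivity)]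
      have h4 := Real.one_sub_inv_le_log_of_pos (x := ((n : ℝ) + 1) / W / (n / W)) (by positivity)
      refine le_trans (le_of_eq ?_) h4
      field_simp
      ring
    rw [h2]
    have h5 : W / ((n : ℝ) + 1) = W * (1 / (n + 1)) := by ring
    have h6 := mul_le_mul_of_nonneg_left h3 hW.le
    push_cast
    linarith

end Deviation

/-! ### Discounted counts and summation by parts. -/

section Weights

/-- The discounted count `∑ i < u, γ ^ (u - 1 - i) b i`. -/
noncomputable def discountedCount (γ : ℝ) (b : ℕ → ℝ) : ℕ → ℝ
  | 0 => 0
  | u + 1 => γ * discountedCount γ b u + b u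

variable {γ : ℝ} {b : ℕ → ℝ}

lemma discountedCount_nonneg (hγ : 0 ≤ γ) (hb : ∀ u, 0 ≤ b u) (u : ℕ) :
    0 ≤ discountedCount γ b u := by
  induction u with
  | zero => exact le_rfl
  | succ u ih => exact add_nonneg (mul_nonneg hγ ih) (hb u)

lemma discountedCount_le (hγ : 0 ≤ γ) (hγ' : γ < 1) (hb : ∀ u, b u ≤ 1) (u : ℕ) :
    discountedCount γ b u ≤ 1 / (1 - γ) := by
  have h1 : 0 < 1 - γ := by linarith
  induction u with
  | zero => exact one_div_nonneg.2 h1.le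
  | succ u ih =>
    calc _ ≤ γ * (1 / (1 - γ)) + 1 := add_le_add (mul_le_mul_of_nonneg_left ih hγ) (hb u)
      _ = 1 / (1 - γ) := by field_simp; ring

lemma sum_discountedCount_le (hγ : 0 ≤ γ) (hγ' : γ < 1) (hb : ∀ u, 0 ≤ b u) (T : ℕ) :
    ∑ u ∈ Finset.range T, discountedCount γ b (u + 1) ≤
      1 / (1 - γ) * ∑ u ∈ Finset.range T, b u := by
  have h1 : 0 < 1 - γ := by linarith
  have h2 : ∑ u ∈ Finset.range T, discountedCount γ b u ≤
      ∑ u ∈ Finset.range T, discountedCount γ b (u + 1) := by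
    have := Finset.sum_range_succ' (discountedCount γ b) T
    rw [Finset.sum_range_succ] at this
    have h3 := discountedCount_nonneg hγ hb T
    have h4 : discountedCount γ b 0 = 0 := rfl
    linarith
  have h5 : ∑ u ∈ Finset.range T, discountedCount γ b (u + 1) =
      γ * ∑ u ∈ Finset.range T, discountedCount γ b u + ∑ u ∈ Finset.range T, b u := by
    rw [Finset.mul_sum, ← Finset.sum_add_distrib]
    rfl
  rw [one_div, inv_mul_eq_div, le_div_iff₀ h1]
  nlinarith [mul_le_mul_of_nonneg_left h2 hγ]

/-- The marks pick out single times, whereas Bellman relations link consecutive ones; on the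
right-hand side only one-step differences and a boundary term remain. -/
lemma sum_mul_eq_discountedCount (z : ℕ → ℝ) (T : ℕ) :
    ∑ u ∈ Finset.range T, b u * z u =
      ∑ u ∈ Finset.range T, discountedCount γ b (u + 1) * (z u - γ * z (u + 1)) +
        γ * discountedCount γ b T * z T := by
  induction T with
  | zero => simp [discountedCount]
  | succ T ih =>
    rw [Finset.sum_range_succ, Finset.sum_range_succ, ih]
    simp only [discountedCount]
    ring

/-- Telescoping, since `γ` times a discounted count is at most the next one. -/
lemma discount_mul_sum_le (hb : ∀ u, 0 ≤ b u) {a : ℕ → ℝ} (ha : ∀ u, 0 ≤ a u)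
    (T : ℕ) : γ * ∑ u ∈ Finset.range T, discountedCount γ b (u + 1) * a (u + 1) ≤
      ∑ u ∈ Finset.range T, discountedCount γ b (u + 1) * a u +
        γ * (discountedCount γ b T * a T) := by
  induction T with
  | zero => simp [discountedCount]
  | succ T ih =>
    rw [Finset.sum_range_succ, Finset.sum_range_succ, mul_add]
    have h1 : discountedCount γ b (T + 1) * a T =
      γ * (discountedCount γ b T * a T) + b T * a T := by rw [discountedCount]; ring
    have := mul_nonneg (hb T) (ha T)
    linarith

end Weights

/-! ### The total variance bound. -/

section TotalVariance

variable {S : Type*} [Fintype S]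

/-- The total variance of a process that approximately satisfies a Bellman equation. -/
lemma discounted_variance_le {γ : ℝ} (hγ : 0 ≤ γ) (hγ' : γ < 1) {b : ℕ → ℝ}
    (hb : ∀ u, 0 ≤ b u) (hb' : ∀ u, b u ≤ 1) {G : ℝ} (hG : G = 1 / (1 - γ)) {W : ℝ} (hW : 1 ≤ W)
    {p g : ℕ → S → ℝ} (hp : ∀ u, p u ∈ stdSimplex ℝ S) {Y x : ℕ → ℝ}
    (hY : ∀ u, 0 ≤ Y u) (hY' : ∀ u, Y u ≤ G) (hx : ∀ u, 0 ≤ x u) (T : ℕ)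
    (h : ∀ u < T, Y u - γ * mean (p u) (g u) ≤ x u)
    (hE : ∑ u ∈ Finset.range T, discountedCount γ b (u + 1) *
        (mean (p u) (fun s => g u s ^ 2) - Y (u + 1) ^ 2) ≤
      (∑ u ∈ Finset.range T, discountedCount γ b (u + 1) * var (p u) (g u)) / 2 + 8 * G ^ 3 * W) :
    γ ^ 2 * ∑ u ∈ Finset.range T, discountedCount γ b (u + 1) * var (p u) (g u) ≤
      18 * G ^ 3 * W + 4 * G * ∑ u ∈ Finset.range T, discountedCount γ b (u + 1) * x u := by
  set w := discountedCount γ b with hw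
  have hw0 := discountedCount_nonneg hγ hb
  have hwG := discountedCount_le hγ hγ' hb'
  rw [← hw] at hw0 hwG
  rw [← hG] at hwG
  have hG0 : 0 ≤ G := (hw0 0).trans (hwG 0)
  -- For `m = γ * mean`, the hypothesis `m ≥ Y - x` gives `m ^ 2 ≥ 2 Y m - Y ^ 2 ≥ Y ^ 2 - 2 Y x`,
  -- whatever the sign of `Y - x`.
  have h1 : ∀ u ∈ Finset.range T, w (u + 1) * (γ ^ 2 * mean (p u) (g u) ^ 2) ≥
      w (u + 1) * Y u ^ 2 - 2 * G * (w (u + 1) * x u) := by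
    intro u hu
    have h2 := h u (Finset.mem_range.1 hu)
    have h3 : Y u ^ 2 - 2 * G * x u ≤ γ ^ 2 * mean (p u) (g u) ^ 2 := by
      nlinarith [sq_nonneg (Y u - γ * mean (p u) (g u)), mul_le_mul_of_nonneg_left h2 (hY u),
        mul_le_mul_of_nonneg_right (hY' u) (hx u)]
    nlinarith [mul_le_mul_of_nonneg_left h3 (hw0 (u + 1))]
  have h2 := Finset.sum_le_sum h1
  rw [Finset.sum_sub_distrib, ← Finset.mul_sum] at h2
  have h3 := discount_mul_sum_le (γ := γ) hb (a := fun u => Y u ^ 2) (fun u => sq_nonneg _) T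
  rw [← hw] at h3
  have h4 : γ * (w T * Y T ^ 2) ≤ G ^ 3 := by
    have h5 : Y T ^ 2 ≤ G ^ 2 := pow_le_pow_left₀ (hY T) (hY' T) 2
    calc γ * (w T * Y T ^ 2) ≤ w T * Y T ^ 2 :=
          mul_le_of_le_one_left (mul_nonneg (hw0 T) (sq_nonneg _)) hγ'.le
      _ ≤ G * G ^ 2 := mul_le_mul (hwG T) h5 (sq_nonneg _) hG0
      _ = G ^ 3 := by ring
  have h5 : ∑ u ∈ Finset.range T, w (u + 1) * (mean (p u) (fun s => g u s ^ 2) - Y (u + 1) ^ 2) =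
      ∑ u ∈ Finset.range T, w (u + 1) * var (p u) (g u) +
      ∑ u ∈ Finset.range T, w (u + 1) * mean (p u) (g u) ^ 2 -
      ∑ u ∈ Finset.range T, w (u + 1) * Y (u + 1) ^ 2 := by
    rw [← Finset.sum_add_distrib, ← Finset.sum_sub_distrib]
    refine Finset.sum_congr rfl fun u _ => ?_
    rw [mean_sq (hp u)]
    ring
  rw [h5] at hE
  have h6 : ∑ u ∈ Finset.range T, w (u + 1) * (γ ^ 2 * mean (p u) (g u) ^ 2) =
      γ ^ 2 * ∑ u ∈ Finset.range T, w (u + 1) * mean (p u) (g u) ^ 2 := by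
    rw [Finset.mul_sum]
    exact Finset.sum_congr rfl fun u _ => by ring
  rw [h6] at h2
  set V := ∑ u ∈ Finset.range T, w (u + 1) * var (p u) (g u)
  set Mn := ∑ u ∈ Finset.range T, w (u + 1) * mean (p u) (g u) ^ 2
  have hY2 : 0 ≤ ∑ u ∈ Finset.range T, w (u + 1) * Y (u + 1) ^ 2 :=
    Finset.sum_nonneg fun u _ => mul_nonneg (hw0 _) (sq_nonneg _)
  set Y2 := ∑ u ∈ Finset.range T, w (u + 1) * Y (u + 1) ^ 2
  have h7 : γ ^ 2 ≤ 1 := pow_le_one₀ hγ hγ'.le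
  have h8 : γ ^ 2 * Y2 ≤ γ * Y2 := mul_le_mul_of_nonneg_right (by nlinarith) hY2
  have h9 := mul_le_mul_of_nonneg_left hE (sq_nonneg γ)
  have hGW : 0 ≤ 8 * G ^ 3 * W := by positivity
  have h10 : γ ^ 2 * (8 * G ^ 3 * W) ≤ 8 * G ^ 3 * W := mul_le_of_le_one_left hGW h7
  have h11 : G ^ 3 ≤ G ^ 3 * W := le_mul_of_one_le_right (by positivity) hW
  -- Half of the variance from `hE` is absorbed on the left. Doubling the rest gives `4 G` and `18 =
  -- 2 * (8 + 1)`, the `1` being the boundary term.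
  nlinarith

end TotalVariance

/-! ### Bellman errors along a trajectory. -/

section Pathwise

variable {S A : Type*} [Fintype S] [Fintype A] [Nonempty A] (Λ : Learner S)

lemma Learner.sum_mul_sqWidth_le {W : ℝ} (hW : 0 < W) {N : ℕ} (hN : W ≤ N) {w : ℕ → ℝ}
    {G c : ℝ} (hw : ∀ u, 0 ≤ w u) (hwG : ∀ u, w u ≤ G) (ω : ℕ → S) (T : ℕ)
    (hc : ∑ u ∈ Finset.range T, w u ≤ c) :
    ∑ u ∈ Finset.range T,
        w u * sqWidth W (min (Λ.used ω u (ω u) (Λ.action ω u : A)).length N) ≤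
      G * (Fintype.card S * Fintype.card A * (W + 3 + W * Real.log (N / W))) + c * (W / N) := by
  classical
  -- The shift `j - 1` allows for the unused sample. Beyond the cap the squared width stays at `W /
  -- N` and is charged to the total weight.
  set f : ℕ → ℝ := fun j => if j < N + 1 then sqWidth W (j - 1) else 0 with hf
  have hf0 : ∀ j, 0 ≤ f j := by
    intro j
    simp only [hf]
    split_ifs
    · exact sqWidth_nonneg hW _
    · exact le_rfl
  have hN0 : (0 : ℝ) < N := hW.trans_le hN
  have hG : 0 ≤ G := (hw 0).trans (hwG 0)
  have h1 : ∀ u, sqWidth W (min (Λ.used ω u (ω u) (Λ.action ω u : A)).length N) ≤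
      f (Λ.available ω u (ω u) (Λ.action ω u : A)).length + W / N := by
    intro u
    have h2 := Λ.length_available_le ω u (ω u) (Λ.action ω u : A)
    rcases lt_or_ge (Λ.used ω u (ω u) (Λ.action ω u : A)).length N with h | h
    · rw [min_eq_left h.le]
      simp only [hf]
      rw [if_pos (by omega)]
      have := sqWidth_anti hW (Nat.sub_le_of_le_add h2)
      have : 0 ≤ W / N := by positivity
      linarith
    · rw [min_eq_right h, sqWidth, if_neg (not_lt.2 hN)]
      linarith [hf0 (Λ.available ω u (ω u) (Λ.action ω u : A)).length]
  have h2 : ∀ n, ∑ j ∈ Finset.range n, f j ≤ W + 3 + W * Real.log (N / W) := by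
    intro n
    have h3 : ∑ j ∈ Finset.range n, f j ≤ ∑ j ∈ Finset.range (N + 1), sqWidth W (j - 1) := by
      simp only [hf]
      rw [← Finset.sum_filter]
      refine Finset.sum_le_sum_of_subset_of_nonneg (fun j hj => ?_) fun j _ _ => sqWidth_nonneg hW _
      exact Finset.mem_range.2 (Finset.mem_filter.1 hj).2
    refine h3.trans ?_
    rw [Finset.sum_range_succ']
    have h4 := sum_sqWidth_le hW hN
    rw [Finset.sum_range_succ] at h4
    have h5 := sqWidth_nonneg hW N
    -- By truncated subtraction the size `0` is counted twice, whence `W + 3` instead of `W + 2`.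
    have h6 := sqWidth_le_one hW (0 - 1)
    simp only [Nat.add_sub_cancel]
    linarith
  have h3 : ∑ u ∈ Finset.range T, f (Λ.available ω u (ω u) (Λ.action ω u : A)).length ≤
      Fintype.card S * Fintype.card A * (W + 3 + W * Real.log (N / W)) := by
    have h4 : ∀ u, f (Λ.available ω u (ω u) (Λ.action ω u : A)).length =
        ∑ s : S, ∑ a : A, if s = ω u ∧ a = Λ.action ω u then f (Λ.available ω u s a).length
          else 0 := by
      intro u
      rw [Finset.sum_eq_single (ω u) (fun s _ hs => by simp [hs]) (by simp),
        Finset.sum_eq_single (Λ.action ω u) (fun s _ hs => by simp [hs]) (by simp)]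
      simp
    rw [Finset.sum_congr rfl fun u _ => h4 u, Finset.sum_comm]
    calc _ ≤ ∑ _s : S, ∑ _a : A, (W + 3 + W * Real.log (N / W)) := by
          refine Finset.sum_le_sum fun s _ => ?_
          rw [Finset.sum_comm]
          refine Finset.sum_le_sum fun a _ => ?_
          have := Λ.sum_length_available ω f T s a
          convert (this.trans_le (h2 _))
      _ = _ := by simp; ring
  calc _ ≤ ∑ u ∈ Finset.range T, (G * f (Λ.available ω u (ω u) (Λ.action ω u : A)).length +
          w u * (W / N)) := by
        refine Finset.sum_le_sum fun u _ => ?_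
        have h4 := mul_le_mul_of_nonneg_left (h1 u) (hw u)
        have h5 := mul_le_mul_of_nonneg_right (hwG u)
          (hf0 (Λ.available ω u (ω u) (Λ.action ω u : A)).length)
        linarith
    _ = G * ∑ u ∈ Finset.range T, f (Λ.available ω u (ω u) (Λ.action ω u : A)).length +
          (∑ u ∈ Finset.range T, w u) * (W / N) := by
        rw [Finset.sum_add_distrib, Finset.mul_sum, Finset.sum_mul]
    _ ≤ _ := add_le_add (mul_le_mul_of_nonneg_left h3 hG)
        (mul_le_mul_of_nonneg_right hc (by positivity))

/-- The learner knows the rewards and the discount factor of the MDP. -/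
structure Learner.Knows (Λ : Learner S) (M : MDP S A) : Prop where
  r_eq : Λ.r = M.r
  γ_eq : Λ.γ = M.γ

/-- All transition probabilities are plausible at time `u`. -/
def Learner.Calibrated (M : MDP S A) (ω : ℕ → S) (u : ℕ) : Prop :=
  ∀ s a, (fun s' => (M.p s a s').toReal) ∈ plausible Λ.width Λ.cap (Λ.used ω u s a)

variable {Λ} {M : MDP S A}

/-- The total decrease of the optimistic value function from time `u` to time `u + 1`. -/
noncomputable def Learner.decrease (Λ : Learner S) (A : Type*) [Fintype A] [Nonempty A]
    (ω : ℕ → S) (u : ℕ) : ℝ :=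
  ∑ s, (Λ.optimisticValue (Λ.used ω u : Samples S A) s -
    Λ.optimisticValue (Λ.used ω (u + 1) : Samples S A) s)

lemma Learner.sub_nonneg_optimisticValue (Λ : Learner S) (ω : ℕ → S) (u : ℕ) (s : S) :
    0 ≤ Λ.optimisticValue (Λ.used ω u : Samples S A) s -
      Λ.optimisticValue (Λ.used ω (u + 1) : Samples S A) s :=
  sub_nonneg.2 (Λ.optimisticValue_anti (Λ.used_prefix_succ ω u) s)

lemma Learner.decrease_nonneg (Λ : Learner S) (ω : ℕ → S) (u : ℕ) : 0 ≤ Λ.decrease A ω u :=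
  Finset.sum_nonneg fun s _ => Λ.sub_nonneg_optimisticValue ω u s

/-- The sum telescopes in every state, so passing to the next optimistic value function costs an
amount that does not depend on `T`. -/
lemma Learner.sum_decrease_le (hγ : Λ.γ < 1) (ω : ℕ → S) (T : ℕ) :
    ∑ u ∈ Finset.range T, Λ.decrease A ω u ≤ Fintype.card S * (1 / (1 - Λ.γ)) := by
  unfold decrease
  rw [Finset.sum_comm]
  calc _ ≤ ∑ _s : S, 1 / (1 - Λ.γ) := by
        refine Finset.sum_le_sum fun s _ => ?_
        rw [Finset.sum_range_sub']
        linarith [Λ.optimisticValue_nonneg (Λ.used ω T : Samples S A) s,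
          Λ.optimisticValue_le hγ (Λ.used ω 0 : Samples S A) s]
    _ = _ := by simp

lemma Learner.mean_sub_le_decrease (Λ : Learner S) {p : S → ℝ} (hp : p ∈ stdSimplex ℝ S)
    (ω : ℕ → S) (u : ℕ) :
    mean p (Λ.optimisticValue (Λ.used ω u : Samples S A)) -
      mean p (Λ.optimisticValue (Λ.used ω (u + 1) : Samples S A)) ≤ Λ.decrease A ω u := by
  rw [← mean_sub]
  refine Finset.sum_le_sum fun s _ => ?_
  refine mul_le_of_le_one_left (Λ.sub_nonneg_optimisticValue ω u s) ?_
  exact (Finset.single_le_sum (fun s _ => hp.1 s) (Finset.mem_univ s)).trans hp.2.le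

/-- A drop is at most `1 / (1 - γ)`, so its second moment is at most that multiple of the drop
itself. -/
lemma Learner.var_le_decrease (hγ : Λ.γ < 1) {p : S → ℝ} (hp : p ∈ stdSimplex ℝ S)
    (ω : ℕ → S) (u : ℕ) :
    var p (Λ.optimisticValue (Λ.used ω u : Samples S A)) ≤
      2 * var p (Λ.optimisticValue (Λ.used ω (u + 1) : Samples S A)) +
        2 * (1 / (1 - Λ.γ) * Λ.decrease A ω u) := by
  set f := Λ.optimisticValue (Λ.used ω u : Samples S A)
  set g := Λ.optimisticValue (Λ.used ω (u + 1) : Samples S A)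
  have hd : ∀ s, 0 ≤ f s - g s := Λ.sub_nonneg_optimisticValue ω u
  have h1 : var p (fun s => f s - g s) ≤ 1 / (1 - Λ.γ) * Λ.decrease A ω u := by
    refine (var_le_sum_mul_sub_sq hp _ 0).trans ?_
    rw [decrease, Finset.mul_sum]
    refine Finset.sum_le_sum fun s _ => ?_
    have h2 : p s ≤ 1 := (Finset.single_le_sum (fun s _ => hp.1 s) (Finset.mem_univ s)).trans hp.2.le
    have h3 : f s - g s ≤ 1 / (1 - Λ.γ) := by
      linarith [Λ.optimisticValue_nonneg (Λ.used ω (u + 1) : Samples S A) s,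
          Λ.optimisticValue_le hγ (Λ.used ω u : Samples S A) s]
    rw [sub_zero]
    calc p s * (f s - g s) ^ 2 ≤ (f s - g s) ^ 2 := mul_le_of_le_one_left (sq_nonneg _) h2
      _ = (f s - g s) * (f s - g s) := sq _
      _ ≤ _ := mul_le_mul_of_nonneg_right h3 (hd s)
  have h2 : f = fun s => g s - (g s - f s) := by funext s; ring
  have h3 : var p (fun s => g s - f s) = var p (fun s => f s - g s) := by
    have : (fun s => g s - f s) = fun s => (-1) * (f s - g s) := by funext s; ring
    rw [this, var_const_mul]
    ring
  have h4 := var_sub_le hp g (fun s => g s - f s)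
  rw [← h2, h3] at h4
  linarith

lemma Learner.prob_policy (ω : ℕ → S) (u : ℕ) :
    prob M Λ.policy u ω = fun s' => (M.p (ω u) (Λ.action ω u) s').toReal := by
  funext s
  rw [prob, Λ.policy_hist]

/-- The error in the optimistic Bellman equation at time `u`, for a parameter `η`. -/
noncomputable def Learner.bellmanError (Λ : Learner S) (M : MDP S A) (ω : ℕ → S) (η : ℝ)
    (u : ℕ) : ℝ :=
  2 * η * (Λ.γ ^ 2 * var (prob M Λ.policy u ω)
      (Λ.optimisticValue (Λ.used ω (u + 1) : Samples S A))) +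
    (2 * η * (1 / (1 - Λ.γ)) + 1) * Λ.decrease A ω u +
    (4 / η + 12 * (1 / (1 - Λ.γ))) * (Fintype.card S *
      sqWidth Λ.width (min (Λ.used ω u (ω u) (Λ.action ω u : A)).length Λ.cap))

lemma Learner.bellmanError_nonneg (hγ : Λ.γ < 1) (hW : 0 < Λ.width) (ω : ℕ → S) {η : ℝ}
    (hη : 0 < η) (u : ℕ) : 0 ≤ Λ.bellmanError M ω η u := by
  have h1 := var_nonneg (prob_mem M Λ.policy u ω)
    (Λ.optimisticValue (Λ.used ω (u + 1) : Samples S A))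
  have h2 := Λ.decrease_nonneg (A := A) ω u
  have h3 := sqWidth_nonneg hW (min (Λ.used ω u (ω u) (Λ.action ω u : A)).length Λ.cap)
  have h4 : 0 < 1 - Λ.γ := by linarith
  unfold bellmanError
  positivity

variable [MeasurableSpace S] [DiscreteMeasurableSpace S]

lemma Learner.Calibrated.optValue_mem (hΛ : Λ.Knows M) {ω : ℕ → S} {u : ℕ}
    (h : Λ.Calibrated M ω u) : optValue M ∈ Λ.subsolutions (Λ.used ω u : Samples S A) := by
  refine ⟨fun s => ⟨optValue_nonneg M s, hΛ.γ_eq ▸ optValue_le M s⟩, fun s => ?_⟩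
  obtain ⟨a, ha⟩ := exists_optValue_le M s
  exact ⟨a, _, h s a, by rw [hΛ.r_eq, hΛ.γ_eq]; exact ha⟩

/-- Two replacements in the optimistic Bellman inequality: the true probabilities for a plausible
distribution, and the value function of time `u + 1` for that of time `u`. The second one matches
the martingale increments. -/
lemma Learner.optimisticValue_sub_le (hΛ : Λ.Knows M) (hW : 0 < Λ.width) {ω : ℕ → S} {u : ℕ}
    (h : Λ.Calibrated M ω u) {η : ℝ} (hη : 0 < η) :
    Λ.optimisticValue (Λ.used ω u : Samples S A) (ω u) - Λ.γ * mean (prob M Λ.policy u ω)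
        (Λ.optimisticValue (Λ.used ω (u + 1) : Samples S A)) ≤
      M.r (ω u) + Λ.bellmanError M ω η u := by
  have hγ0 : 0 < Λ.γ := hΛ.γ_eq ▸ M.γ_mem.1
  have hγ1 : Λ.γ < 1 := hΛ.γ_eq ▸ M.γ_mem.2
  have hG : 0 < 1 - Λ.γ := by linarith
  have hp := prob_mem M Λ.policy u ω
  have hpl := h (ω u) (Λ.action ω u)
  rw [← Λ.prob_policy] at hpl
  set p := prob M Λ.policy u ω with hpdef
  set f := Λ.optimisticValue (Λ.used ω u : Samples S A) with hf
  set g := Λ.optimisticValue (Λ.used ω (u + 1) : Samples S A) with hg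
  set φ := Fintype.card S *
      sqWidth Λ.width (min (Λ.used ω u (ω u) (Λ.action ω u : A)).length Λ.cap) with hφ
  set R := η * (Λ.γ ^ 2 * var p f) + (4 / η + 12 * (1 / (1 - Λ.γ))) * φ with hR
  -- The bound `c` is chosen so that `γ * c = γ * mean p f + R`.
  have h1 : f (ω u) ≤ Λ.r (ω u) + Λ.γ * ((Λ.γ * mean p f + R) / Λ.γ) := by
    refine Λ.optimisticValue_le_of_forall hγ0.le hγ1 ⟨_, h.optValue_mem hΛ⟩ ⟨_, hpl⟩ ?_
    intro q hq
    have h2 := mean_sub_mean_le_of_mem_plausible hW hpl hq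
      (Λ.optimisticValue_nonneg (Λ.used ω u : Samples S A))
      (Λ.optimisticValue_le hγ1 (Λ.used ω u : Samples S A)) hγ0.le hγ1.le hη
    rw [le_div_iff₀ hγ0]
    linarith
  rw [mul_div_cancel₀ _ hγ0.ne', hΛ.r_eq] at h1
  have h2 := Λ.mean_sub_le_decrease (A := A) hp ω u
  rw [← hf, ← hg] at h2
  have h3 := Λ.var_le_decrease (A := A) hγ1 hp ω u
  rw [← hf, ← hg] at h3
  have hd := Λ.decrease_nonneg (A := A) ω u
  have h4 : Λ.γ * mean p f ≤ Λ.γ * mean p g + Λ.decrease A ω u := by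
    have := mul_le_mul_of_nonneg_left h2 hγ0.le
    have h5 : Λ.γ * Λ.decrease A ω u ≤ Λ.decrease A ω u := mul_le_of_le_one_left hd hγ1.le
    linarith
  have h5 : η * (Λ.γ ^ 2 * var p f) ≤ 2 * η * (Λ.γ ^ 2 * var p g) +
      2 * η * (1 / (1 - Λ.γ)) * Λ.decrease A ω u := by
    have h6 : Λ.γ ^ 2 * var p f ≤ 2 * (Λ.γ ^ 2 * var p g) +
        2 * (1 / (1 - Λ.γ) * Λ.decrease A ω u) := by
      have h7 := mul_le_mul_of_nonneg_left h3 (sq_nonneg Λ.γ)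
      have h8 : Λ.γ ^ 2 * (2 * (1 / (1 - Λ.γ) * Λ.decrease A ω u)) ≤
          2 * (1 / (1 - Λ.γ) * Λ.decrease A ω u) :=
        mul_le_of_le_one_left (by positivity) (pow_le_one₀ hγ0.le hγ1.le)
      linarith
    have := mul_le_mul_of_nonneg_left h6 hη.le
    linarith
  unfold bellmanError
  rw [← hpdef, ← hg, ← hφ]
  linarith

end Pathwise

/-! ### The gap between optimistic and actual value. -/

section Regret

/-- The arithmetic that turns the variance and deviation bounds into the final estimate. -/
lemma gap_arithmetic {G ε W K P n V V' X X' R : ℝ} (hG : 1 ≤ G) (hε : 0 < ε) (hεG : ε ≤ G)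
    (hW : 0 < W) (hWP : 60 * (G * W) ≤ P) (hnP : 100 * (n * G) ≤ P) (hn : 1 ≤ n)
    (hK : 1000 * (P * G ^ 2) / ε ^ 2 ≤ K)
    (hX : X ≤ 2 * (1 / (16 * G)) * V + (2 * (1 / (16 * G)) * G + 1) * (G * (n * G)) +
      (4 / (1 / (16 * G)) + 12 * G) * P)
    (hX' : X' ≤ 2 * (ε / (60 * G ^ 2)) * V + (2 * (ε / (60 * G ^ 2)) * G + 1) * (G * (n * G)) +
      (4 / (ε / (60 * G ^ 2)) + 12 * G) * P)
    (hV : V ≤ 18 * G ^ 3 * W + 4 * G * (G * K + X))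
    (hV' : V' ≤ 18 * G ^ 3 * W + 4 * G * (G * K))
    (hR : R ≤ X' + (ε / (200 * G ^ 3) * (2 * G * (V + V')) + W / (ε / (200 * G ^ 3))) + G ^ 2) :
    R < ε * K := by
  have hG0 : 0 < G := by linarith
  have hP : 0 < P := by
    have : 0 < G * W := by positivity
    linarith
  -- Lower-order terms are measured in units of `Q`; by `hK`, `ε * K` contains a thousand of them.
  set Q := P * G ^ 2 / ε with hQ
  have hQ0 : 0 < Q := by positivity
  have hKQ : 1000 * Q ≤ ε * K := by
    have h1 := mul_le_mul_of_nonneg_left hK hε.le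
    refine le_trans (le_of_eq ?_) h1
    rw [hQ]
    field_simp
  have hPK : 1000 * P ≤ K := by
    refine le_trans ?_ hK
    rw [le_div_iff₀ (by positivity)]
    have h1 : ε ^ 2 ≤ G ^ 2 := pow_le_pow_left₀ hε.le hεG 2
    linarith [mul_le_mul_of_nonneg_left h1 hP.le]
  have hGP : G * P ≤ Q := by
    rw [hQ, le_div_iff₀ hε]
    have := mul_le_mul_of_nonneg_left hεG (mul_pos hG0 hP).le
    linarith
  have e1 : 2 * (1 / (16 * G)) * V = V / (8 * G) := by field_simp; ring
  have e2 : 2 * (1 / (16 * G)) * G = 1 / 8 := by field_simp; ring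
  have e3 : 4 / (1 / (16 * G)) = 64 * G := by field_simp; ring
  rw [e1, e2, e3] at hX
  -- The choice `η = 1 / (16 G)` returns exactly half of `V`, which `hV` can absorb.
  have hX1 : 4 * G * X ≤ V / 2 + 4.5 * (G ^ 2 * (n * G)) + 304 * (G ^ 2 * P) := by
    have h1 := mul_le_mul_of_nonneg_left hX (show 0 ≤ 4 * G by positivity)
    have h2 : 4 * G * (V / (8 * G)) = V / 2 := by field_simp; ring
    linarith
  have hG2 : 0 < G ^ 2 := by positivity
  have a1 := mul_le_mul_of_nonneg_left hWP hG2.le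
  have a2 := mul_le_mul_of_nonneg_left hnP hG2.le
  have a4 : 0 < G ^ 2 * P := by positivity
  have a3 := mul_le_mul_of_nonneg_left hPK hG2.le
  have hVK : V ≤ 9 * (G ^ 2 * K) := by linarith
  have hV'K : V' ≤ 5 * (G ^ 2 * K) := by linarith
  have b1 : 2 * (ε / (60 * G ^ 2)) * V ≤ 0.3 * (ε * K) := by
    have h1 := mul_le_mul_of_nonneg_left hVK (show 0 ≤ 2 * (ε / (60 * G ^ 2)) by positivity)
    refine h1.trans (le_of_eq ?_)
    field_simp
    ring
  have b2 : (2 * (ε / (60 * G ^ 2)) * G + 1) * (G * (n * G)) ≤ 2 * Q := by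
    have h1 : 2 * (ε / (60 * G ^ 2)) * G ≤ 1 := by
      have : 2 * (ε / (60 * G ^ 2)) * G = ε / (30 * G) := by field_simp; ring
      rw [this, div_le_one (by positivity)]
      linarith
    have h2 : G * (n * G) ≤ Q := by
      refine le_trans ?_ hGP
      have : n * G ≤ P := by linarith [mul_pos (show 0 < n by linarith) hG0]
      exact mul_le_mul_of_nonneg_left this hG0.le
    have h3 : 0 ≤ G * (n * G) := by positivity
    linarith [mul_le_mul_of_nonneg_right h1 h3]
  have b3 : (4 / (ε / (60 * G ^ 2)) + 12 * G) * P ≤ 252 * Q := by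
    have : 4 / (ε / (60 * G ^ 2)) * P = 240 * Q := by rw [hQ]; field_simp; ring
    linarith
  have b4 : ε / (200 * G ^ 3) * (2 * G * (V + V')) ≤ 0.14 * (ε * K) := by
    have h1 : V + V' ≤ 14 * (G ^ 2 * K) := by linarith
    have h2 := mul_le_mul_of_nonneg_left h1
      (show 0 ≤ ε / (200 * G ^ 3) * (2 * G) by positivity)
    calc _ = ε / (200 * G ^ 3) * (2 * G) * (V + V') := by ring
      _ ≤ _ := h2
      _ = _ := by field_simp; ring
  have b5 : W / (ε / (200 * G ^ 3)) ≤ 4 * Q := by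
    have h1 : W / (ε / (200 * G ^ 3)) = 200 * (G ^ 2 * (G * W)) / ε := by field_simp
    have h2 : 4 * Q = 4 * (G ^ 2 * P) / ε := by rw [hQ]; ring
    rw [h1, h2]
    exact div_le_div_of_nonneg_right (by linarith) hε.le
  have b6 : G ^ 2 ≤ Q := by
    refine le_trans ?_ hGP
    have : G ≤ P := by linarith [mul_le_mul_of_nonneg_right hn hG0.le]
    rw [sq]
    exact mul_le_mul_of_nonneg_left this hG0.le
  -- The total is at most `(0.3 + 0.14) ε K + 259 Q`, and `259 Q ≤ 0.259 ε K`.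
  linarith

section NextValue

variable {S A : Type*} [Fintype S]
variable [MeasurableSpace S] [DiscreteMeasurableSpace S]

/-- The value of a policy after the history at time `u`, followed by a given next state. -/
noncomputable def nextValue (M : MDP S A) (π : Policy S A) (ω : ℕ → S) (u : ℕ) (s : S) : ℝ :=
  value M π ((hist ω u).snoc s)

lemma value_hist_succ (M : MDP S A) (π : Policy S A) (ω : ℕ → S) (u : ℕ) :
    value M π (hist ω (u + 1)) = nextValue M π ω u (ω (u + 1)) := by
  rw [nextValue, hist_succ]

lemma value_hist_eq (M : MDP S A) (π : Policy S A) (ω : ℕ → S) (u : ℕ) :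
    value M π (hist ω u) = M.r (ω u) + M.γ * mean (prob M π u ω) (nextValue M π ω u) :=
  value_eq M π (hist ω u)

end NextValue

variable {S A : Type*} [Fintype S]

/-- Turns the complement of a Freedman event into the hypothesis `hE` of `discounted_variance_le`.
Since `w ^ 2 Var(g ^ 2) ≤ G w * 4 G ^ 2 Var g`, the parameter `1 / (8 G ^ 3)` leaves half of the
variance. The minus sign is there because conditional means must not exceed realised values by much.
-/
lemma sum_mul_sq_le_of_not_le {G W : ℝ} (hG : 0 < G) {w : ℕ → ℝ} (hw : ∀ u, 0 ≤ w u)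
    (hwG : ∀ u, w u ≤ G) {p g : ℕ → S → ℝ} (hp : ∀ u, p u ∈ stdSimplex ℝ S)
    (hg : ∀ u s, 0 ≤ g u s) (hgG : ∀ u s, g u s ≤ G) {Y : ℕ → ℝ} {T : ℕ}
    (h : ¬1 / (8 * G ^ 3) * ∑ u ∈ Finset.range T, var (p u) (fun s => -w (u + 1) * g u s ^ 2) +
        W / (1 / (8 * G ^ 3)) ≤
      ∑ u ∈ Finset.range T, (-w (u + 1) * Y (u + 1) ^ 2 -
        mean (p u) (fun s => -w (u + 1) * g u s ^ 2))) :
    ∑ u ∈ Finset.range T, w (u + 1) * (mean (p u) (fun s => g u s ^ 2) - Y (u + 1) ^ 2) ≤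
      (∑ u ∈ Finset.range T, w (u + 1) * var (p u) (g u)) / 2 + 8 * G ^ 3 * W := by
  rw [not_le] at h
  have h1 : ∑ u ∈ Finset.range T, (-w (u + 1) * Y (u + 1) ^ 2 -
      mean (p u) (fun s => -w (u + 1) * g u s ^ 2)) =
      ∑ u ∈ Finset.range T, w (u + 1) * (mean (p u) (fun s => g u s ^ 2) - Y (u + 1) ^ 2) := by
    refine Finset.sum_congr rfl fun u _ => ?_
    rw [mean_const_mul]
    ring
  rw [h1] at h
  refine h.le.trans (add_le_add ?_ (le_of_eq (by field_simp)))
  rw [Finset.mul_sum, Finset.sum_div]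
  refine Finset.sum_le_sum fun u _ => ?_
  rw [var_const_mul, neg_sq]
  have h2 := var_sq_le (hp u) (hg u) (hgG u)
  have hv := var_nonneg (hp u) (g u)
  have h3 : w (u + 1) ^ 2 * var (p u) (fun s => g u s ^ 2) ≤
      G * w (u + 1) * (4 * G ^ 2 * var (p u) (g u)) := by
    refine mul_le_mul ?_ h2 (var_nonneg (hp u) _) (mul_nonneg hG.le (hw _))
    rw [sq]
    exact mul_le_mul_of_nonneg_right (hwG _) (hw _)
  calc _ ≤ 1 / (8 * G ^ 3) * (G * w (u + 1) * (4 * G ^ 2 * var (p u) (g u))) :=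
        mul_le_mul_of_nonneg_left h3 (by positivity)
    _ = _ := by field_simp; ring

variable [Fintype A] [Nonempty A] {Λ : Learner S} {M : MDP S A}

lemma Learner.sum_mul_bellmanError_le (hγ : Λ.γ < 1)
    {G : ℝ} (hG : G = 1 / (1 - Λ.γ)) {w : ℕ → ℝ}
    (hwG : ∀ u, w u ≤ G) (ω : ℕ → S) (T : ℕ) {η F : ℝ} (hη : 0 < η)
    (hF : ∑ u ∈ Finset.range T, w (u + 1) * sqWidth Λ.width
      (min (Λ.used ω u (ω u) (Λ.action ω u : A)).length Λ.cap) ≤ F) :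
    ∑ u ∈ Finset.range T, w (u + 1) * Λ.bellmanError M ω η u ≤
      2 * η * (Λ.γ ^ 2 * ∑ u ∈ Finset.range T, w (u + 1) * var (prob M Λ.policy u ω)
        (Λ.optimisticValue (Λ.used ω (u + 1) : Samples S A))) +
      (2 * η * G + 1) * (G * (Fintype.card S * G)) +
      (4 / η + 12 * G) * (Fintype.card S * F) := by
  have hG0 : 0 < G := by
    rw [hG]
    have : 0 < 1 - Λ.γ := by linarith
    positivity
  have h1 : ∑ u ∈ Finset.range T, w (u + 1) * Λ.decrease A ω u ≤ G * (Fintype.card S * G) := by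
    have := Λ.sum_decrease_le (A := A) hγ ω T
    rw [← hG] at this
    refine le_trans ?_ (mul_le_mul_of_nonneg_left this hG0.le)
    rw [Finset.mul_sum]
    exact Finset.sum_le_sum fun u _ =>
      mul_le_mul_of_nonneg_right (hwG _) (Λ.decrease_nonneg ω u)
  have h2 : ∑ u ∈ Finset.range T, w (u + 1) * Λ.bellmanError M ω η u =
      2 * η * (Λ.γ ^ 2 * ∑ u ∈ Finset.range T, w (u + 1) * var (prob M Λ.policy u ω)
        (Λ.optimisticValue (Λ.used ω (u + 1) : Samples S A))) +
      (2 * η * G + 1) * ∑ u ∈ Finset.range T, w (u + 1) * Λ.decrease A ω u +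
      (4 / η + 12 * G) * (Fintype.card S * ∑ u ∈ Finset.range T, w (u + 1) * sqWidth Λ.width
      (min (Λ.used ω u (ω u) (Λ.action ω u : A)).length Λ.cap)) := by
    simp only [Finset.mul_sum]
    rw [← Finset.sum_add_distrib, ← Finset.sum_add_distrib]
    refine Finset.sum_congr rfl fun u _ => ?_
    rw [bellmanError, ← hG]
    ring
  rw [h2]
  have h3 : 0 ≤ 2 * η * G + 1 := by positivity
  have h4 : 0 ≤ 4 / η + 12 * G := by positivity
  have h5 : (Fintype.card S : ℝ) * ∑ u ∈ Finset.range T, w (u + 1) * sqWidth Λ.width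
      (min (Λ.used ω u (ω u) (Λ.action ω u : A)).length Λ.cap) ≤ Fintype.card S * F :=
    mul_le_mul_of_nonneg_left hF (Nat.cast_nonneg _)
  linarith [mul_le_mul_of_nonneg_left h1 h3, mul_le_mul_of_nonneg_left h5 h4]

variable [MeasurableSpace S] [DiscreteMeasurableSpace S]

/-- If all transition probabilities are plausible and the martingales that belong to the
trajectory are not exceptionally large, then the learner loses little at the times marked by `b`. -/
lemma Learner.sum_gap_lt (hΛ : Λ.Knows M) {G : ℝ} (hG : G = 1 / (1 - Λ.γ))
    (hW : 1 ≤ Λ.width) {ω : ℕ → S} {T : ℕ} (hcal : ∀ u < T, Λ.Calibrated M ω u)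
    {b : ℕ → ℝ} (hb : ∀ u, 0 ≤ b u) (hb' : ∀ u, b u ≤ 1) {ε K P : ℝ} (hε : 0 < ε) (hεG : ε ≤ G)
    (hbK : ∑ u ∈ Finset.range T, b u ≤ K)
    (hF : Fintype.card S * ∑ u ∈ Finset.range T, discountedCount Λ.γ b (u + 1) * sqWidth Λ.width
      (min (Λ.used ω u (ω u) (Λ.action ω u : A)).length Λ.cap) ≤ P)
    (hWP : 60 * (G * Λ.width) ≤ P) (hnP : 100 * (Fintype.card S * G) ≤ P)
    (hK : 1000 * (P * G ^ 2) / ε ^ 2 ≤ K)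
    (hE₁ : ¬1 / (8 * G ^ 3) * ∑ u ∈ Finset.range T, var (prob M Λ.policy u ω)
        (fun s => -discountedCount Λ.γ b (u + 1) *
          Λ.optimisticValue (Λ.used ω (u + 1) : Samples S A) s ^ 2) +
        Λ.width / (1 / (8 * G ^ 3)) ≤
      ∑ u ∈ Finset.range T, (-discountedCount Λ.γ b (u + 1) *
          Λ.optimisticValue (Λ.used ω (u + 1) : Samples S A) (ω (u + 1)) ^ 2 -
        mean (prob M Λ.policy u ω) (fun s => -discountedCount Λ.γ b (u + 1) *
          Λ.optimisticValue (Λ.used ω (u + 1) : Samples S A) s ^ 2)))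
    (hE₂ : ¬1 / (8 * G ^ 3) * ∑ u ∈ Finset.range T, var (prob M Λ.policy u ω)
        (fun s => -discountedCount Λ.γ b (u + 1) * nextValue M Λ.policy ω u s ^ 2) +
        Λ.width / (1 / (8 * G ^ 3)) ≤
      ∑ u ∈ Finset.range T, (-discountedCount Λ.γ b (u + 1) *
          nextValue M Λ.policy ω u (ω (u + 1)) ^ 2 -
        mean (prob M Λ.policy u ω) (fun s => -discountedCount Λ.γ b (u + 1) *
          nextValue M Λ.policy ω u s ^ 2)))
    (hE₃ : ¬ε / (200 * G ^ 3) * ∑ u ∈ Finset.range T, var (prob M Λ.policy u ω)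
        (fun s => -(Λ.γ * discountedCount Λ.γ b (u + 1)) *
          (Λ.optimisticValue (Λ.used ω (u + 1) : Samples S A) s - nextValue M Λ.policy ω u s)) +
        Λ.width / (ε / (200 * G ^ 3)) ≤
      ∑ u ∈ Finset.range T, (-(Λ.γ * discountedCount Λ.γ b (u + 1)) *
          (Λ.optimisticValue (Λ.used ω (u + 1) : Samples S A) (ω (u + 1)) -
            nextValue M Λ.policy ω u (ω (u + 1))) -
        mean (prob M Λ.policy u ω) (fun s => -(Λ.γ * discountedCount Λ.γ b (u + 1)) *
          (Λ.optimisticValue (Λ.used ω (u + 1) : Samples S A) s - nextValue M Λ.policy ω u s)))) :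
    ∑ u ∈ Finset.range T, b u *
      (Λ.optimisticValue (Λ.used ω u : Samples S A) (ω u) - value M Λ.policy (hist ω u)) <
      ε * K := by
  have hγ0 : 0 < Λ.γ := hΛ.γ_eq ▸ M.γ_mem.1
  have hγ1 : Λ.γ < 1 := hΛ.γ_eq ▸ M.γ_mem.2
  have hγ : 0 < 1 - Λ.γ := by linarith
  have hGM : G = 1 / (1 - M.γ) := by rw [hG, hΛ.γ_eq]
  have hG1 : 1 ≤ G := by rw [hG, le_div_iff₀ hγ]; linarith
  have hG0 : 0 < G := by linarith
  have hS : (1 : ℝ) ≤ Fintype.card S := by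
    have : Nonempty S := ⟨ω 0⟩
    exact_mod_cast Fintype.card_pos
  have hwidth : 0 < Λ.width := by linarith
  set w := discountedCount Λ.γ b with hwdef
  have hw : ∀ u, 0 ≤ w u := discountedCount_nonneg hγ0.le hb
  have hwG : ∀ u, w u ≤ G := hG ▸ discountedCount_le hγ0.le hγ1 hb'
  have hwK : ∑ u ∈ Finset.range T, w (u + 1) ≤ G * K := by
    refine (sum_discountedCount_le hγ0.le hγ1 hb T).trans ?_
    rw [← hG]
    exact mul_le_mul_of_nonneg_left hbK hG0.le
  have hp := fun u => prob_mem M Λ.policy u ω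
  set p := fun u => prob M Λ.policy u ω with hpdef
  set g := fun u => Λ.optimisticValue (Λ.used ω (u + 1) : Samples S A) with hg
  set g' := fun u => nextValue M Λ.policy ω u with hg'
  set Y := fun u => Λ.optimisticValue (Λ.used ω u : Samples S A) (ω u) with hY
  set Y' := fun u => value M Λ.policy (hist ω u) with hY'
  have hY'succ : ∀ u, Y' (u + 1) = g' u (ω (u + 1)) := fun u => value_hist_succ M Λ.policy ω u
  have g0 : ∀ u s, 0 ≤ g u s := fun u => Λ.optimisticValue_nonneg _
  have gG : ∀ u s, g u s ≤ G := fun u => hG ▸ Λ.optimisticValue_le hγ1 _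
  have g0' : ∀ u s, 0 ≤ g' u s := fun u s => value_nonneg M Λ.policy _
  have gG' : ∀ u s, g' u s ≤ G := fun u s => hGM ▸ value_le M Λ.policy _
  have Y0 : ∀ u, 0 ≤ Y u := fun u => Λ.optimisticValue_nonneg _ _
  have YG : ∀ u, Y u ≤ G := fun u => hG ▸ Λ.optimisticValue_le hγ1 _ _
  have Y0' : ∀ u, 0 ≤ Y' u := fun u => value_nonneg M Λ.policy _
  have YG' : ∀ u, Y' u ≤ G := fun u => hGM ▸ value_le M Λ.policy _
  have hstep : ∀ {η : ℝ}, 0 < η → ∀ u < T, Y u - Λ.γ * mean (p u) (g u) ≤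
      M.r (ω u) + Λ.bellmanError M ω η u :=
    fun hη u hu => Λ.optimisticValue_sub_le hΛ hwidth (hcal u hu) hη
  have hstep' : ∀ u, Y' u - Λ.γ * mean (p u) (g' u) = M.r (ω u) := by
    intro u
    have := value_hist_eq M Λ.policy ω u
    simp only [hY', hpdef, hg', hΛ.γ_eq]
    linarith
  have hr : ∀ u, M.r (ω u) ≤ 1 := fun u => (M.r_mem _).2
  have hη₁ : 0 < 1 / (16 * G) := by positivity
  have hη₂ : 0 < ε / (60 * G ^ 2) := by positivity
  have hX : ∀ {η : ℝ}, 0 < η → ∑ u ∈ Finset.range T, w (u + 1) * Λ.bellmanError M ω η u ≤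
      2 * η * (Λ.γ ^ 2 * ∑ u ∈ Finset.range T, w (u + 1) * var (p u) (g u)) +
      (2 * η * G + 1) * (G * (Fintype.card S * G)) + (4 / η + 12 * G) * P := by
    intro η hη
    refine (Λ.sum_mul_bellmanError_le hγ1 hG hwG ω T hη le_rfl).trans ?_
    exact add_le_add le_rfl (mul_le_mul_of_nonneg_left hF (by positivity))
  set V := Λ.γ ^ 2 * ∑ u ∈ Finset.range T, w (u + 1) * var (p u) (g u) with hV
  set V' := Λ.γ ^ 2 * ∑ u ∈ Finset.range T, w (u + 1) * var (p u) (g' u) with hV'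
  -- The slack contains the Bellman error, which contains `V` again; `gap_arithmetic` resolves the
  -- circularity.
  have hVle : V ≤ 18 * G ^ 3 * Λ.width + 4 * G * (G * K +
      ∑ u ∈ Finset.range T, w (u + 1) * Λ.bellmanError M ω (1 / (16 * G)) u) := by
    have h1 := discounted_variance_le hγ0.le hγ1 hb hb' hG hW (g := g) hp Y0 YG
      (x := fun u => 1 + Λ.bellmanError M ω (1 / (16 * G)) u)
      (fun u => add_nonneg zero_le_one (Λ.bellmanError_nonneg hγ1 hwidth ω hη₁ u)) T
      (fun u hu => (hstep hη₁ u hu).trans (by linarith [hr u]))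
      (sum_mul_sq_le_of_not_le hG0 hw hwG hp g0 gG hE₁)
    refine h1.trans (add_le_add le_rfl (mul_le_mul_of_nonneg_left ?_ (by positivity)))
    simp only [mul_add, mul_one, Finset.sum_add_distrib]
    exact add_le_add hwK le_rfl
  have hVle' : V' ≤ 18 * G ^ 3 * Λ.width + 4 * G * (G * K) := by
    have hE₂' := hE₂
    simp only [← value_hist_succ] at hE₂'
    have h1 := discounted_variance_le hγ0.le hγ1 hb hb' hG hW (g := g') hp Y0' YG'
      (x := fun _ => 1) (fun _ => zero_le_one) T (fun u _ => (hstep' u).trans_le (hr u))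
      (sum_mul_sq_le_of_not_le hG0 hw hwG hp g0' gG' (Y := Y') hE₂')
    refine h1.trans (add_le_add le_rfl (mul_le_mul_of_nonneg_left ?_ (by positivity)))
    simpa using hwK
  refine gap_arithmetic hG1 hε hεG hwidth hWP hnP hS hK (hX hη₁) (hX hη₂) hVle hVle' ?_
  rw [sum_mul_eq_discountedCount (γ := Λ.γ)]
  have hlast : Λ.γ * w T * (Y T - Y' T) ≤ G ^ 2 := by
    have h1 : Λ.γ * w T ≤ G := (mul_le_of_le_one_left (hw T) hγ1.le).trans (hwG T)
    have h2 : Y T - Y' T ≤ G := by linarith [YG T, Y0' T]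
    have h3 : 0 ≤ Λ.γ * w T := mul_nonneg hγ0.le (hw T)
    calc _ ≤ Λ.γ * w T * G := mul_le_mul_of_nonneg_left h2 h3
      _ ≤ G * G := mul_le_mul_of_nonneg_right h1 hG0.le
      _ = G ^ 2 := (sq G).symm
  rw [not_le] at hE₃
  have hmart : ∑ u ∈ Finset.range T, (-(Λ.γ * w (u + 1)) * (g u (ω (u + 1)) - g' u (ω (u + 1))) -
        mean (p u) (fun s => -(Λ.γ * w (u + 1)) * (g u s - g' u s))) ≤
      ε / (200 * G ^ 3) * (2 * G * (V + V')) + Λ.width / (ε / (200 * G ^ 3)) := by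
    refine hE₃.le.trans (add_le_add (mul_le_mul_of_nonneg_left ?_ (by positivity)) le_rfl)
    have h1 : 2 * G * (V + V') = ∑ u ∈ Finset.range T,
        Λ.γ ^ 2 * (G * w (u + 1)) * (2 * var (p u) (g u) + 2 * var (p u) (g' u)) := by
      rw [hV, hV', ← mul_add, ← Finset.sum_add_distrib, Finset.mul_sum, Finset.mul_sum]
      exact Finset.sum_congr rfl fun u _ => by ring
    rw [h1]
    refine Finset.sum_le_sum fun u _ => ?_
    rw [var_const_mul, neg_sq, mul_pow]
    refine mul_le_mul ?_ (var_sub_le (hp u) _ _) (var_nonneg (hp u) _) ?_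
    · refine mul_le_mul_of_nonneg_left ?_ (sq_nonneg _)
      rw [sq]
      exact mul_le_mul_of_nonneg_right (hwG _) (hw _)
    · exact mul_nonneg (sq_nonneg _) (mul_nonneg hG0.le (hw _))
  -- The rewards cancel between the two Bellman relations, leaving the Bellman error and the
  -- martingale increment of the difference of the next values.
  have hsum : ∑ u ∈ Finset.range T, w (u + 1) * ((Y u - Y' u) - Λ.γ * (Y (u + 1) - Y' (u + 1))) ≤
      ∑ u ∈ Finset.range T, w (u + 1) * Λ.bellmanError M ω (ε / (60 * G ^ 2)) u +
      ∑ u ∈ Finset.range T, (-(Λ.γ * w (u + 1)) * (g u (ω (u + 1)) - g' u (ω (u + 1))) -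
        mean (p u) (fun s => -(Λ.γ * w (u + 1)) * (g u s - g' u s))) := by
    rw [← Finset.sum_add_distrib]
    refine Finset.sum_le_sum fun u hu => ?_
    rw [mean_const_mul, mean_sub, hY'succ]
    have h1 := mul_le_mul_of_nonneg_left (hstep hη₂ u (Finset.mem_range.1 hu)) (hw (u + 1))
    have h2 := hstep' u
    have h3 : Y (u + 1) = g u (ω (u + 1)) := rfl
    rw [h3]
    have h4 : Y' u = M.r (ω u) + Λ.γ * mean (p u) (g' u) := by linarith
    rw [h4]
    change _ ≤ _ + (-(Λ.γ * w (u + 1)) * (g u (ω (u + 1)) - g' u (ω (u + 1))) -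
      -(Λ.γ * w (u + 1)) * (mean (p u) (g u) - mean (p u) (g' u)))
    linarith
  linarith

end Regret

/-! ### Plausibility of the true probabilities. -/

section Calibration

variable {S A : Type*} [Fintype S] [Fintype A] [Nonempty A] (Λ : Learner S) (M : MDP S A)

open scoped Classical in
/-- The indicator, up to a sign, that one of the first `n` samples for `(s, a)` is drawn at time
`u` and equals `s'`. -/
noncomputable def Learner.sampleIndicator (c : ℝ) (s : S) (a : A) (s' : S) (n u : ℕ)
    (ω : ℕ → S) (x : S) : ℝ :=
  (if s = ω u ∧ a = Λ.action ω u then (if (Λ.available ω u s a).length < n then c else 0) else 0) *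
    if x = s' then 1 else 0

/-- The parameter of the exponential moment bound that suits the mean `y`. -/
noncomputable def tiltParam (W y : ℝ) : ℝ := if W ≤ y then √(W / y) else 1

lemma tiltParam_pos {W : ℝ} (hW : 0 < W) (y : ℝ) : 0 < tiltParam W y := by
  unfold tiltParam
  split_ifs with h
  · have : 0 < y := hW.trans_le h
    positivity
  · exact one_pos

lemma tiltParam_le_one {W : ℝ} (hW : 0 < W) (y : ℝ) : tiltParam W y ≤ 1 := by
  unfold tiltParam
  split_ifs with h
  · refine Real.sqrt_le_iff.2 ⟨zero_le_one, ?_⟩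
    rw [one_pow]
    exact (div_le_one (hW.trans_le h)).2 h
  · exact le_rfl

/-- `√(W / y)` minimises `l * y + W / l`, but Freedman's inequality needs `l ≤ 1`. In the other case
`y < W`, and `l = 1` gives `y + W ≤ 2 W`. -/
lemma tiltParam_mul_add_le {W : ℝ} (hW : 0 < W) (y : ℝ) :
    tiltParam W y * y + W / tiltParam W y ≤ 2 * √(y * W) + 2 * W := by
  unfold tiltParam
  split_ifs with h
  · have hy : 0 < y := hW.trans_le h
    have h1 : √(W / y) * y = √(y * W) := by
      rw [Real.sqrt_div hW.le, mul_comm y W, Real.sqrt_mul hW.le]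
      nth_rewrite 2 [← Real.mul_self_sqrt hy.le]
      have := Real.sqrt_pos.2 hy
      field_simp
    have h2 : W / √(W / y) = √(y * W) := by
      rw [Real.sqrt_div hW.le, mul_comm y W, Real.sqrt_mul hW.le]
      nth_rewrite 1 [← Real.mul_self_sqrt hW.le]
      have := Real.sqrt_pos.2 hy
      have := Real.sqrt_pos.2 hW
      field_simp
    rw [h1, h2]
    linarith
  · have := Real.sqrt_nonneg (y * W)
    linarith

lemma Learner.nonanticipating_sampleIndicator (c : ℝ) (s : S) (a : A) (s' : S) (n : ℕ) :
    Nonanticipating (Λ.sampleIndicator c s a s' n) := by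
  intro u ω ω' h
  have h1 := Λ.nonanticipating_available (A := A) u ω ω' h
  have h2 := Λ.nonanticipating_action (A := A) u ω ω' h
  simp only at h1 h2
  funext x
  unfold sampleIndicator
  rw [h1, h2, h u le_rfl]

lemma mean_indicator [DecidableEq S] (p : S → ℝ) (c : ℝ) (s' : S) :
    mean p (fun x => c * if x = s' then 1 else 0) = c * p s' := by
  rw [mean_const_mul]
  simp [mean]

lemma Learner.mean_sampleIndicator (c : ℝ) (s : S) (a : A) (s' : S) (n u : ℕ) (ω : ℕ → S) :
    mean (prob M Λ.policy u ω) (Λ.sampleIndicator c s a s' n u ω) =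
      (open scoped Classical in if s = ω u ∧ a = Λ.action ω u then
        (if (Λ.available ω u s a).length < n then c else 0) else 0) * (M.p s a s').toReal := by
  classical
  unfold sampleIndicator
  rw [mean_indicator, Λ.prob_policy]
  by_cases h : s = ω u ∧ a = Λ.action ω u
  · rw [h.1, h.2]
  · simp [h]

lemma Learner.var_sampleIndicator_le {c : ℝ} (hc : c ^ 2 = 1) (s : S) (a : A) (s' : S) (n u : ℕ)
    (ω : ℕ → S) :
    var (prob M Λ.policy u ω) (Λ.sampleIndicator c s a s' n u ω) ≤
      (open scoped Classical in if s = ω u ∧ a = Λ.action ω u then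
        (if (Λ.available ω u s a).length < n then 1 else 0) else 0) * (M.p s a s').toReal := by
  classical
  refine (var_le_sum_mul_sub_sq (prob_mem M Λ.policy u ω) _ 0).trans (le_of_eq ?_)
  have h1 := Λ.mean_sampleIndicator M 1 s a s' n u ω
  rw [← h1, mean]
  refine Finset.sum_congr rfl fun x _ => ?_
  unfold sampleIndicator
  split_ifs <;> simp [hc]

/-- The event that the first `n` samples for `(s, a)` contain `s'` unusually often (`c = 1`) or
rarely (`c = -1`). -/
def Learner.miscounted (c : ℝ) (T : ℕ) (s : S) (a : A) (s' : S) (n : ℕ) : Set (ℕ → S) :=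
  {ω | tiltParam Λ.width (n * (M.p s a s').toReal) * ∑ u ∈ Finset.range T,
      var (prob M Λ.policy u ω) (Λ.sampleIndicator c s a s' n u ω) +
      Λ.width / tiltParam Λ.width (n * (M.p s a s').toReal) ≤
    ∑ u ∈ Finset.range T, (Λ.sampleIndicator c s a s' n u ω (ω (u + 1)) -
      mean (prob M Λ.policy u ω) (Λ.sampleIndicator c s a s' n u ω))}

variable {Λ M}

open scoped Classical in
lemma Learner.sum_indicator_length (ω : ℕ → S) (T n : ℕ) (s : S) (a : A) (c : ℝ) :
    (∑ u ∈ Finset.range T, if s = ω u ∧ a = Λ.action ω u then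
      (if (Λ.available ω u s a).length < n then c else 0) else 0) =
      (min n (Λ.available ω T s a).length : ℕ) * c := by
  have h1 := Λ.sum_length_available ω (fun j => if j < n then c else 0) T s a
  refine h1.trans ?_
  rw [← Finset.sum_filter, Finset.sum_const, nsmul_eq_mul]
  congr 2
  have : (Finset.range (Λ.available ω T s a).length).filter (fun j => j < n) =
      Finset.range (min n (Λ.available ω T s a).length) := by
    ext j
    simp [and_comm]
  rw [this, Finset.card_range]

/-- Exactly `n` samples are counted, so the variances add up to at most `n` times the true
probability and the random Freedman bound becomes a fixed width. -/
lemma Learner.lt_of_notMem_miscounted (hW : 0 < Λ.width) {c : ℝ} (hc : c ^ 2 = 1) {T : ℕ} {s : S}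
    {a : A} {s' : S} {n : ℕ} {ω : ℕ → S} (h : ω ∉ Λ.miscounted M c T s a s' n)
    (hn : n ≤ (Λ.available ω T s a).length) :
    open scoped Classical in
    c * ((((Λ.available ω T s a).take n).count s' : ℝ) - n * (M.p s a s').toReal) <
      2 * √(n * (M.p s a s').toReal * Λ.width) + 2 * Λ.width := by
  classical
  set q := (M.p s a s').toReal with hq
  have hq0 : 0 ≤ q := ENNReal.toReal_nonneg
  have h' := h
  rw [miscounted, Set.mem_ofPred_eq, not_le] at h'
  have h1 : ∑ u ∈ Finset.range T, (Λ.sampleIndicator c s a s' n u ω (ω (u + 1)) -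
      mean (prob M Λ.policy u ω) (Λ.sampleIndicator c s a s' n u ω)) =
      c * ((((Λ.available ω T s a).take n).count s' : ℝ) - n * q) := by
    rw [Finset.sum_sub_distrib, Finset.sum_congr rfl fun u _ => Λ.mean_sampleIndicator M c s a s' n u ω,
      ← Finset.sum_mul, sum_indicator_length, min_eq_left hn, Λ.count_take_available ω n T s a s',
      mul_sub, Finset.mul_sum]
    congr 1
    · refine Finset.sum_congr rfl fun u _ => ?_
      unfold sampleIndicator
      by_cases h2 : s = ω u ∧ a = Λ.action ω u
      · by_cases h3 : (Λ.available ω u s a).length < n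
        · rw [if_pos h2, if_pos h3, if_pos (⟨h2.1, h2.2, h3⟩ : _ ∧ _ ∧ _)]
        · have h5 : ¬(s = ω u ∧ a = Λ.action ω u ∧ (Λ.available ω u s a).length < n) :=
            fun h4 => h3 h4.2.2
          rw [if_pos h2, if_neg h3, if_neg h5]
          ring
      · have h5 : ¬(s = ω u ∧ a = Λ.action ω u ∧ (Λ.available ω u s a).length < n) :=
          fun h4 => h2 ⟨h4.1, h4.2.1⟩
        rw [if_neg h2, if_neg h5]
        ring
    · rw [← hq]
      ring
  rw [h1] at h'
  refine h'.trans_le (le_trans (add_le_add (mul_le_mul_of_nonneg_left ?_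
    (tiltParam_pos hW _).le) le_rfl) (tiltParam_mul_add_le hW _))
  refine (Finset.sum_le_sum fun u _ => Λ.var_sampleIndicator_le M hc s a s' n u ω).trans ?_
  rw [← Finset.sum_mul, sum_indicator_length, min_eq_left hn, mul_one]

/-- Records used before `T` are prefixes of those available at `T`, so events at the single time `T`
control all earlier times. -/
lemma Learner.calibrated_of_notMem_miscounted (hW : 0 < Λ.width) {T : ℕ} {ω : ℕ → S}
    (h : ∀ s a s' n, n ≤ Λ.cap → ∀ c : ℝ, c = 1 ∨ c = -1 → ω ∉ Λ.miscounted M c T s a s' n) :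
    ∀ u < T, Λ.Calibrated M ω u := by
  classical
  intro u hu s a
  refine ⟨toReal_pmf_mem_stdSimplex _, fun n hn hN s' => ?_⟩
  have h1 : Λ.used ω u s a <+: Λ.available ω T s a :=
    (Λ.used_prefix_available ω u s a).trans (Λ.available_prefix ω hu.le s a)
  have hn' := hn.trans h1.length_le
  have h2 : (Λ.used ω u s a).take n = (Λ.available ω T s a).take n := by
    obtain ⟨t, ht⟩ := h1
    rw [← ht, List.take_append_of_le_length hn]
  have h3 := lt_of_notMem_miscounted hW (by norm_num) (h s a s' n hN 1 (Or.inl rfl)) hn'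
  have h4 := lt_of_notMem_miscounted hW (by norm_num) (h s a s' n hN (-1) (Or.inr rfl)) hn'
  rw [h2, abs_le]
  constructor
  · convert (show -(2 * √(n * (M.p s a s').toReal * Λ.width) + 2 * Λ.width) ≤
      n * (M.p s a s').toReal - (((Λ.available ω T s a).take n).count s' : ℝ) by linarith)
  · convert (show n * (M.p s a s').toReal - (((Λ.available ω T s a).take n).count s' : ℝ) ≤
      2 * √(n * (M.p s a s').toReal * Λ.width) + 2 * Λ.width by linarith)

variable [MeasurableSpace S] [DiscreteMeasurableSpace S]

lemma Learner.processLaw_miscounted_le (hW : 0 < Λ.width) {c : ℝ} (hc : c = 1 ∨ c = -1) (T : ℕ)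
    (s₁ s : S) (a : A) (s' : S) (n : ℕ) :
    processLaw M Λ.policy s₁ (Λ.miscounted M c T s a s' n) ≤
      ENNReal.ofReal (Real.exp (-Λ.width)) := by
  classical
  refine processLaw_freedman M Λ.policy s₁ (Λ.nonanticipating_sampleIndicator c s a s' n)
    (tiltParam_pos hW _) (fun u ω x => ?_) T Λ.width
  have h1 := Λ.mean_sampleIndicator M c s a s' n u ω
  have h0 : 0 ≤ (M.p s a s').toReal := ENNReal.toReal_nonneg
  have h0' : (M.p s a s').toReal ≤ 1 :=
    ENNReal.toReal_le_of_le_ofReal zero_le_one (by simpa using PMF.coe_le_one _ _)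
  have h2 : Λ.sampleIndicator c s a s' n u ω x -
      mean (prob M Λ.policy u ω) (Λ.sampleIndicator c s a s' n u ω) ≤ 1 := by
    rw [h1]
    unfold sampleIndicator
    rcases hc with rfl | rfl <;> split_ifs <;> linarith
  have h3 := tiltParam_le_one hW (n * (M.p s a s').toReal)
  have h4 := tiltParam_pos hW (n * (M.p s a s').toReal)
  nlinarith

end Calibration

/-! ### Marking the first bad times. -/

section Marks

/-- The number of times before `u` that have the property `B`. -/
noncomputable def countBefore (B : ℕ → Prop) (u : ℕ) : ℕ :=
  open scoped Classical in ((Finset.range u).filter B).card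

/-- The indicator of the first `K` times that have the property `B`. -/
noncomputable def mark (K : ℕ) (B : ℕ → Prop) (u : ℕ) : ℝ :=
  open scoped Classical in if B u ∧ countBefore B u < K then 1 else 0

lemma mark_nonneg (K : ℕ) (B : ℕ → Prop) (u : ℕ) : 0 ≤ mark K B u := by
  unfold mark
  split_ifs <;> norm_num

lemma mark_le_one (K : ℕ) (B : ℕ → Prop) (u : ℕ) : mark K B u ≤ 1 := by
  unfold mark
  split_ifs <;> norm_num

lemma countBefore_succ (B : ℕ → Prop) (u : ℕ) :
    countBefore B (u + 1) = countBefore B u + (open scoped Classical in if B u then 1 else 0) := by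
  classical
  unfold countBefore
  rw [Finset.range_add_one, Finset.filter_insert]
  split_ifs with h
  · rw [Finset.card_insert_of_notMem (by simp)]
  · rfl

lemma sum_mark (K : ℕ) (B : ℕ → Prop) (T : ℕ) :
    ∑ u ∈ Finset.range T, mark K B u = (min (countBefore B T) K : ℕ) := by
  classical
  induction T with
  | zero => simp [countBefore]
  | succ T ih =>
    rw [Finset.sum_range_succ, ih, countBefore_succ, mark]
    by_cases h : B T
    · by_cases h' : countBefore B T < K
      · rw [if_pos ⟨h, h'⟩, if_pos h, min_eq_left h'.le, min_eq_left h']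
        push_cast
        ring
      · rw [if_neg fun h2 => h' h2.2, if_pos h, min_eq_right (by omega), min_eq_right (by omega),
          add_zero]
    · rw [if_neg fun h2 => h h2.1, if_neg h, add_zero, add_zero]

lemma countBefore_congr {B B' : ℕ → Prop} {u : ℕ} (h : ∀ i < u, B i ↔ B' i) :
    countBefore B u = countBefore B' u := by
  classical
  unfold countBefore
  congr 1
  exact Finset.filter_congr fun i hi => h i (Finset.mem_range.1 hi)

lemma mark_congr (K : ℕ) {B B' : ℕ → Prop} {u : ℕ} (h : ∀ i ≤ u, B i ↔ B' i) :
    mark K B u = mark K B' u := by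
  unfold mark
  rw [countBefore_congr fun i hi => h i hi.le]
  rw [propext (h u le_rfl)]

lemma discountedCount_congr (γ : ℝ) {b b' : ℕ → ℝ} {u : ℕ} (h : ∀ i < u, b i = b' i) :
    discountedCount γ b u = discountedCount γ b' u := by
  induction u with
  | zero => rfl
  | succ u ih =>
    rw [discountedCount, discountedCount, ih fun i hi => h i (hi.trans u.lt_succ_self),
      h u u.lt_succ_self]

lemma ncard_le_of_countBefore_le {B : ℕ → Prop} {K : ℕ} (h : ∀ T, countBefore B T ≤ K) :
    {t | B t}.Finite ∧ {t | B t}.ncard ≤ K := by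
  classical
  have h1 : ∀ F : Finset ℕ, (F : Set ℕ) ⊆ {t | B t} → F.card ≤ K := by
    intro F hF
    refine le_trans (Finset.card_le_card fun t ht => ?_) (h (F.sup id + 1))
    exact Finset.mem_filter.2 ⟨Finset.mem_range.2 (Nat.lt_succ_of_le (Finset.le_sup (f := id) ht)),
      hF ht⟩
  have hfin : {t | B t}.Finite := by
    by_contra hinf
    obtain ⟨F, hF, hc⟩ := Set.Infinite.exists_subset_card_eq hinf (K + 1)
    have := h1 F hF
    omega
  refine ⟨hfin, ?_⟩
  rw [Set.ncard_eq_toFinset_card _ hfin]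
  exact h1 _ (by simp)

end Marks

section NextOptimistic

variable {S : Type*} [Fintype S]

/-- The next optimistic value function, as a function of the trajectory. -/
noncomputable def Learner.nextOptimistic (Λ : Learner S) (A : Type*) [Fintype A] [Nonempty A]
    (u : ℕ) (ω : ℕ → S) : S → ℝ :=
  Λ.optimisticValue (Λ.used ω (u + 1) : Samples S A)

lemma Learner.nonanticipating_nextOptimistic (Λ : Learner S) (A : Type*) [Fintype A]
    [Nonempty A] :
    Nonanticipating (Λ.nextOptimistic A) := by
  intro u ω ω' h
  have := Λ.nonanticipating_available (A := A) u ω ω' h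
  simp only at this
  rw [nextOptimistic, nextOptimistic, used_succ, used_succ, this]

end NextOptimistic

/-! ### Exceptional events and the sample complexity. -/

section Probability

variable {S A : Type*} [Fintype S] [MeasurableSpace S] [DiscreteMeasurableSpace S]

/-- The policy `π` loses more than `ε` at time `u`. -/
def IsBad (M : MDP S A) (π : Policy S A) (ε : ℝ) (ω : ℕ → S) (u : ℕ) : Prop :=
  ε < optValue M (ω u) - value M π (hist ω u)

lemma isBad_congr (M : MDP S A) (π : Policy S A) (ε : ℝ) {u : ℕ} {ω ω' : ℕ → S}
    (h : ∀ i ≤ u, ω i = ω' i) : IsBad M π ε ω u ↔ IsBad M π ε ω' u := by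
  unfold IsBad
  rw [h u le_rfl, hist_congr h]

/-- The weight of time `u` when the first `K` bad times are counted. -/
noncomputable def weight (M : MDP S A) (π : Policy S A) (ε : ℝ) (K u : ℕ) (ω : ℕ → S) : ℝ :=
  discountedCount M.γ (mark K (IsBad M π ε ω)) (u + 1)

/-- Badness at time `u` is a property of the history up to `u`, so the weights may multiply
martingale increments. -/
lemma nonanticipating_weight (M : MDP S A) (π : Policy S A) (ε : ℝ) (K : ℕ) :
    Nonanticipating (weight M π ε K) := by
  intro u ω ω' h
  refine discountedCount_congr _ fun i hi => mark_congr K fun j hj => isBad_congr M π ε ?_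
  exact fun k hk => h k (by omega)

lemma weight_nonneg (M : MDP S A) (π : Policy S A) (ε : ℝ) (K u : ℕ) (ω : ℕ → S) :
    0 ≤ weight M π ε K u ω :=
  discountedCount_nonneg M.γ_mem.1.le (mark_nonneg _ _) _

lemma weight_le (M : MDP S A) (π : Policy S A) (ε : ℝ) (K u : ℕ) (ω : ℕ → S) :
    weight M π ε K u ω ≤ 1 / (1 - M.γ) :=
  discountedCount_le M.γ_mem.1.le M.γ_mem.2 (mark_le_one _ _) _

lemma nonanticipating_nextValue (M : MDP S A) (π : Policy S A) :
    Nonanticipating (fun u ω => nextValue M π ω u) := by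
  intro u ω ω' h
  funext s
  simp only [nextValue, hist_congr h]

/-- An exceptional event for a weighted squared value function. -/
def squareDeviation (M : MDP S A) (π : Policy S A) (ε : ℝ) (K : ℕ) (W : ℝ)
    (g : ℕ → (ℕ → S) → S → ℝ) (T : ℕ) : Set (ℕ → S) :=
  {ω | 1 / (8 * (1 / (1 - M.γ)) ^ 3) * ∑ u ∈ Finset.range T, var (prob M π u ω)
        (fun s => -weight M π ε K u ω * g u ω s ^ 2) +
        W / (1 / (8 * (1 / (1 - M.γ)) ^ 3)) ≤
      ∑ u ∈ Finset.range T, (-weight M π ε K u ω * g u ω (ω (u + 1)) ^ 2 -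
        mean (prob M π u ω) (fun s => -weight M π ε K u ω * g u ω s ^ 2))}

lemma processLaw_squareDeviation_le (M : MDP S A) (π : Policy S A) (ε : ℝ) (K : ℕ) (W : ℝ)
    {g : ℕ → (ℕ → S) → S → ℝ} (hg : Nonanticipating g) (h0 : ∀ u ω s, 0 ≤ g u ω s)
    (hG : ∀ u ω s, g u ω s ≤ 1 / (1 - M.γ)) (T : ℕ) (s₁ : S) :
    processLaw M π s₁ (squareDeviation M π ε K W g T) ≤ ENNReal.ofReal (Real.exp (-W)) := by
  have hγ := M.discount_pos
  refine processLaw_freedman M π s₁ (f := fun u ω s => -weight M π ε K u ω * g u ω s ^ 2)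
    (fun u ω ω' h => ?_) (by positivity) (fun u ω s => ?_) T W
  · simp only [nonanticipating_weight M π ε K u ω ω' h, hg u ω ω' h]
  · set G := 1 / (1 - M.γ) with hGdef
    have hG0 : 0 < G := by positivity
    have hw := weight_nonneg M π ε K u ω
    have hwG := weight_le M π ε K u ω
    rw [mean_const_mul]
    have h1 : mean (prob M π u ω) (fun s => g u ω s ^ 2) ≤ G ^ 2 :=
      mean_le (prob_mem M π u ω) fun s => pow_le_pow_left₀ (h0 u ω s) (hG u ω s) 2
    have h1' : 0 ≤ mean (prob M π u ω) (fun s => g u ω s ^ 2) :=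
      mean_nonneg (prob_mem M π u ω) fun s => sq_nonneg _
    have h2 : weight M π ε K u ω * mean (prob M π u ω) (fun s => g u ω s ^ 2) ≤ G * G ^ 2 :=
      mul_le_mul hwG h1 h1' hG0.le
    have h3 : 0 ≤ weight M π ε K u ω * g u ω s ^ 2 := mul_nonneg hw (sq_nonneg _)
    rw [div_mul_eq_mul_div, div_le_one (by positivity)]
    have h4 : 0 < G ^ 3 := by positivity
    linarith

/-- An exceptional event for a weighted difference of value functions. -/
def gapDeviation (M : MDP S A) (π : Policy S A) (ε : ℝ) (K : ℕ) (W : ℝ)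
    (g : ℕ → (ℕ → S) → S → ℝ) (T : ℕ) : Set (ℕ → S) :=
  {ω | ε / (200 * (1 / (1 - M.γ)) ^ 3) * ∑ u ∈ Finset.range T, var (prob M π u ω)
        (fun s => -(M.γ * weight M π ε K u ω) * (g u ω s - nextValue M π ω u s)) +
        W / (ε / (200 * (1 / (1 - M.γ)) ^ 3)) ≤
      ∑ u ∈ Finset.range T, (-(M.γ * weight M π ε K u ω) *
          (g u ω (ω (u + 1)) - nextValue M π ω u (ω (u + 1))) -
        mean (prob M π u ω) (fun s => -(M.γ * weight M π ε K u ω) *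
          (g u ω s - nextValue M π ω u s)))}

lemma processLaw_gapDeviation_le (M : MDP S A) (π : Policy S A) {ε : ℝ} (hε : 0 < ε)
    (hε' : ε ≤ 1 / (1 - M.γ)) (K : ℕ) (W : ℝ)
    {g : ℕ → (ℕ → S) → S → ℝ} (hg : Nonanticipating g) (h0 : ∀ u ω s, 0 ≤ g u ω s)
    (hG : ∀ u ω s, g u ω s ≤ 1 / (1 - M.γ)) (T : ℕ) (s₁ : S) :
    processLaw M π s₁ (gapDeviation M π ε K W g T) ≤ ENNReal.ofReal (Real.exp (-W)) := by
  have hγ := M.discount_pos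
  refine processLaw_freedman M π s₁ (f := fun u ω s =>
      -(M.γ * weight M π ε K u ω) * (g u ω s - nextValue M π ω u s))
    (fun u ω ω' h => ?_) (by positivity) (fun u ω s => ?_) T W
  · have := nonanticipating_nextValue M π u ω ω' h
    simp only at this
    simp only [nonanticipating_weight M π ε K u ω ω' h, hg u ω ω' h, this]
  · have hG1 : 1 ≤ 1 / (1 - M.γ) := by
      rw [le_div_iff₀ hγ]
      linarith [M.γ_mem.1]
    set G := 1 / (1 - M.γ) with hGdef
    have hG0 : 0 < G := by positivity
    have hw : 0 ≤ M.γ * weight M π ε K u ω :=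
      mul_nonneg M.γ_mem.1.le (weight_nonneg M π ε K u ω)
    have hwG : M.γ * weight M π ε K u ω ≤ G :=
      (mul_le_of_le_one_left (weight_nonneg M π ε K u ω) M.γ_mem.2.le).trans
        (weight_le M π ε K u ω)
    have hn : ∀ s, 0 ≤ nextValue M π ω u s := fun s => value_nonneg M π _
    have hnG : ∀ s, nextValue M π ω u s ≤ G := fun s => value_le M π _
    rw [mean_const_mul]
    have h1 : mean (prob M π u ω) (fun s => g u ω s - nextValue M π ω u s) ≤ G :=
      mean_le (prob_mem M π u ω) fun s => by linarith [hG u ω s, hn s]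
    have h2 : mean (prob M π u ω) (fun s => g u ω s - nextValue M π ω u s) -
        (g u ω s - nextValue M π ω u s) ≤ 2 * G := by linarith [h0 u ω s, hnG s]
    have h3 : M.γ * weight M π ε K u ω *
        (mean (prob M π u ω) (fun s => g u ω s - nextValue M π ω u s) -
        (g u ω s - nextValue M π ω u s)) ≤ G * (2 * G) :=
      (mul_le_mul_of_nonneg_left h2 hw).trans (mul_le_mul_of_nonneg_right hwG (by positivity))
    have h4 : ε / (200 * G ^ 3) * (G * (2 * G)) ≤ 1 := by
      rw [div_mul_eq_mul_div, div_le_one (by positivity)]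
      have := mul_le_mul_of_nonneg_right hε' (show 0 ≤ G * (2 * G) by positivity)
      have h5 : 0 < G ^ 3 := by positivity
      linarith
    refine le_trans ?_ h4
    refine mul_le_mul_of_nonneg_left ?_ (by positivity)
    linarith

variable [Fintype A] [Nonempty A] {Λ : Learner S} {M : MDP S A}

/-- The event outside of which the learner is bad at fewer than `K` times before time `T`. -/
def Learner.exceptional (Λ : Learner S) (M : MDP S A) (ε : ℝ) (K T : ℕ) : Set (ℕ → S) :=
  (⋃ i : (S × A × S) × Fin (Λ.cap + 1) × Bool,
    Λ.miscounted M (if i.2.2 then 1 else -1) T i.1.1 i.1.2.1 i.1.2.2 i.2.1) ∪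
  (squareDeviation M Λ.policy ε K Λ.width (Λ.nextOptimistic A) T ∪
    (squareDeviation M Λ.policy ε K Λ.width (fun u ω => nextValue M Λ.policy ω u) T ∪
      gapDeviation M Λ.policy ε K Λ.width (Λ.nextOptimistic A) T))

lemma Learner.processLaw_exceptional_le (hΛ : Λ.Knows M) (hW : 0 < Λ.width) {ε : ℝ} (hε : 0 < ε)
    (hε' : ε ≤ 1 / (1 - M.γ)) (K T : ℕ) (s₁ : S) :
    processLaw M Λ.policy s₁ (Λ.exceptional M ε K T) ≤
      ENNReal.ofReal ((2 * (Fintype.card S ^ 2 * Fintype.card A * (Λ.cap + 1)) + 3) *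
        Real.exp (-Λ.width)) := by
  have hγ1 : Λ.γ < 1 := hΛ.γ_eq ▸ M.γ_mem.2
  have g0 : ∀ u ω s, 0 ≤ Λ.nextOptimistic A u ω s := fun u ω => Λ.optimisticValue_nonneg _
  have gG : ∀ u ω s, Λ.nextOptimistic A u ω s ≤ 1 / (1 - M.γ) := fun u ω =>
    hΛ.γ_eq ▸ Λ.optimisticValue_le hγ1 _
  set e := ENNReal.ofReal (Real.exp (-Λ.width)) with he
  have h1 : processLaw M Λ.policy s₁ (⋃ i : (S × A × S) × Fin (Λ.cap + 1) × Bool,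
      Λ.miscounted M (if i.2.2 then 1 else -1) T i.1.1 i.1.2.1 i.1.2.2 i.2.1) ≤
      Fintype.card ((S × A × S) × Fin (Λ.cap + 1) × Bool) * e := by
    refine (measure_iUnion_fintype_le _ _).trans ?_
    refine (Finset.sum_le_sum fun i _ => Λ.processLaw_miscounted_le hW (by split_ifs <;> simp)
      T s₁ i.1.1 i.1.2.1 i.1.2.2 i.2.1).trans ?_
    simp [he]
  have h2 := processLaw_squareDeviation_le M Λ.policy ε K Λ.width
    (Λ.nonanticipating_nextOptimistic A) g0 gG T s₁
  have h3 := processLaw_squareDeviation_le M Λ.policy ε K Λ.width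
    (nonanticipating_nextValue M Λ.policy) (fun u ω s => value_nonneg M Λ.policy _)
    (fun u ω s => value_le M Λ.policy _) T s₁
  have h4 := processLaw_gapDeviation_le M Λ.policy hε hε' K Λ.width
    (Λ.nonanticipating_nextOptimistic A) g0 gG T s₁
  refine (measure_union_le _ _).trans ((add_le_add h1 ((measure_union_le _ _).trans
    (add_le_add h2 ((measure_union_le _ _).trans (add_le_add h3 h4))))).trans ?_)
  rw [ENNReal.ofReal_mul (by positivity), ← he]
  have h5 : ENNReal.ofReal (2 * (Fintype.card S ^ 2 * Fintype.card A * (Λ.cap + 1)) + 3) =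
      Fintype.card ((S × A × S) × Fin (Λ.cap + 1) × Bool) + 3 := by
    have : (2 * ((Fintype.card S : ℝ) ^ 2 * Fintype.card A * (Λ.cap + 1)) + 3) =
        ((Fintype.card ((S × A × S) × Fin (Λ.cap + 1) × Bool) + 3 : ℕ) : ℝ) := by
      simp only [Fintype.card_prod, Fintype.card_fin, Fintype.card_bool]
      push_cast
      ring
    rw [this, ENNReal.ofReal_natCast]
    push_cast
    rfl
  rw [h5, add_mul]
  refine add_le_add le_rfl (le_of_eq ?_)
  ring

lemma Learner.countBefore_lt_of_notMem_exceptional (hΛ : Λ.Knows M) (hW : 1 ≤ Λ.width)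
    {ε : ℝ} (hε : 0 < ε) (hε' : ε ≤ 1 / (1 - M.γ)) {K T : ℕ} {P : ℝ} (hcap : Λ.width ≤ Λ.cap)
    (hP : Fintype.card S * (1 / (1 - M.γ) * (Fintype.card S * Fintype.card A *
      (Λ.width + 3 + Λ.width * Real.log (Λ.cap / Λ.width))) +
      1 / (1 - M.γ) * K * (Λ.width / Λ.cap)) ≤ P)
    (hWP : 60 * (1 / (1 - M.γ) * Λ.width) ≤ P)
    (hnP : 100 * (Fintype.card S * (1 / (1 - M.γ))) ≤ P)
    (hK : 1000 * (P * (1 / (1 - M.γ)) ^ 2) / ε ^ 2 ≤ K) {ω : ℕ → S}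
    (h : ω ∉ Λ.exceptional M ε K T) : countBefore (IsBad M Λ.policy ε ω) T < K := by
  classical
  by_contra hcount
  rw [not_lt] at hcount
  simp only [exceptional, Set.mem_union, Set.mem_iUnion, not_or, not_exists] at h
  obtain ⟨h1, h2, h3, h4⟩ := h
  have hW0 : 0 < Λ.width := by linarith
  have hcal : ∀ u < T, Λ.Calibrated M ω u := by
    refine Learner.calibrated_of_notMem_miscounted hW0 fun s a s' n hn c hc => ?_
    rcases hc with rfl | rfl
    · exact h1 ((s, a, s'), ⟨n, Nat.lt_succ_of_le hn⟩, true)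
    · exact h1 ((s, a, s'), ⟨n, Nat.lt_succ_of_le hn⟩, false)
  set b := mark K (IsBad M Λ.policy ε ω) with hb
  have hbK : ∑ u ∈ Finset.range T, b u = K := by
    rw [hb, sum_mark, min_eq_right hcount]
  have hγ1 : Λ.γ < 1 := hΛ.γ_eq ▸ M.γ_mem.2
  have hγ0 : 0 < Λ.γ := hΛ.γ_eq ▸ M.γ_mem.1
  have hw : ∀ u, discountedCount Λ.γ b (u + 1) = weight M Λ.policy ε K u ω := fun u => by
    rw [hΛ.γ_eq]; rfl
  have hF := Λ.sum_mul_sqWidth_le (A := A) hW0 hcap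
    (w := fun u => discountedCount Λ.γ b (u + 1))
    (fun u => discountedCount_nonneg hγ0.le (mark_nonneg _ _) _)
    (fun u => discountedCount_le hγ0.le hγ1 (mark_le_one _ _) _) ω T
    ((sum_discountedCount_le hγ0.le hγ1 (mark_nonneg _ _) T).trans
      (by rw [← hb, hbK]))
  rw [hΛ.γ_eq] at hF
  have h5 := Λ.sum_gap_lt hΛ (G := 1 / (1 - M.γ)) (by rw [hΛ.γ_eq]) hW hcal (b := b)
    (mark_nonneg _ _) (mark_le_one _ _) hε hε' hbK.le
    (P := P) (by
      rw [hΛ.γ_eq]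
      exact (mul_le_mul_of_nonneg_left hF (Nat.cast_nonneg _)).trans hP) hWP hnP hK
    (by rw [hΛ.γ_eq]; exact h2) (by rw [hΛ.γ_eq]; exact h3) (by rw [hΛ.γ_eq]; exact h4)
  -- Exactly `K` times are marked, and at each of them the optimistic gap exceeds `ε`, against `h5`.
  rw [← hbK, Finset.mul_sum] at h5
  refine absurd h5 (not_lt.2 (Finset.sum_le_sum fun u hu => ?_))
  rw [mul_comm]
  have h6 := Λ.le_optimisticValue ((hcal u (Finset.mem_range.1 hu)).optValue_mem hΛ) (ω u)
  by_cases h7 : IsBad M Λ.policy ε ω u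
  · refine mul_le_mul_of_nonneg_left ?_ (mark_nonneg _ _ _)
    unfold IsBad at h7
    linarith
  · have : b u = 0 := if_neg fun h8 => h7 h8.1
    rw [this]
    simp

/-- The sample complexity of the learner, in terms of its parameters. -/
theorem Learner.processLaw_ncard_badSteps_lt (hΛ : Λ.Knows M) (hW : 1 ≤ Λ.width)
    {ε δ : ℝ} (hε : 0 < ε) (hε' : ε ≤ 1 / (1 - M.γ)) {K : ℕ} {P : ℝ} (hcap : Λ.width ≤ Λ.cap)
    (hP : Fintype.card S * (1 / (1 - M.γ) * (Fintype.card S * Fintype.card A *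
      (Λ.width + 3 + Λ.width * Real.log (Λ.cap / Λ.width))) +
      1 / (1 - M.γ) * K * (Λ.width / Λ.cap)) ≤ P)
    (hWP : 60 * (1 / (1 - M.γ) * Λ.width) ≤ P)
    (hnP : 100 * (Fintype.card S * (1 / (1 - M.γ))) ≤ P)
    (hK : 1000 * (P * (1 / (1 - M.γ)) ^ 2) / ε ^ 2 ≤ K)
    (hδ : (2 * (Fintype.card S ^ 2 * Fintype.card A * (Λ.cap + 1)) + 3) *
        Real.exp (-Λ.width) ≤ δ) (s₁ : S) :
    ENNReal.ofReal (1 - δ) ≤ processLaw M Λ.policy s₁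
      {ω | (badSteps M Λ.policy ε ω).Finite ∧ (badSteps M Λ.policy ε ω).ncard < K} := by
  have hδ0 : 0 ≤ δ := le_trans (by positivity) hδ
  set E : ℕ → Set (ℕ → S) := fun T => {ω | countBefore (IsBad M Λ.policy ε ω) T < K} with hE
  have hEm : ∀ T, MeasurableSet (E T) := by
    intro T
    have : Nonanticipating fun T ω => countBefore (IsBad M Λ.policy ε ω) T := by
      intro T ω ω' h
      exact countBefore_congr fun i hi => isBad_congr M _ ε fun j hj => h j (by omega)
    exact (this.measurable T) (measurableSet_Iio (a := K))
  -- The estimate for `E T` is uniform in `T`, so continuity from above replaces a union bound over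
  -- time.
  have hEanti : Antitone E := by
    refine antitone_nat_of_succ_le fun T ω hω => ?_
    have h1 : countBefore (IsBad M Λ.policy ε ω) (T + 1) < K := hω
    rw [countBefore_succ] at h1
    exact lt_of_le_of_lt (Nat.le_add_right _ _) h1
  have hET : ∀ T, ENNReal.ofReal (1 - δ) ≤ processLaw M Λ.policy s₁ (E T) := by
    intro T
    have h1 : (E T)ᶜ ⊆ Λ.exceptional M ε K T := by
      intro ω hω
      by_contra h
      exact hω (countBefore_lt_of_notMem_exceptional hΛ hW hε hε' hcap hP hWP hnP hK h)
    have h2 : processLaw M Λ.policy s₁ (E T)ᶜ ≤ ENNReal.ofReal δ :=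
      (measure_mono h1).trans ((processLaw_exceptional_le hΛ (by linarith) hε hε' K T s₁).trans
        (ENNReal.ofReal_le_ofReal hδ))
    rw [ENNReal.ofReal_sub _ hδ0, ENNReal.ofReal_one, tsub_le_iff_right,
      ← prob_add_prob_compl (μ := processLaw M Λ.policy s₁) (hEm T)]
    exact add_le_add le_rfl h2
  have h3 : processLaw M Λ.policy s₁ (⋂ T, E T) = ⨅ T, processLaw M Λ.policy s₁ (E T) :=
    hEanti.measure_iInter (fun T => (hEm T).nullMeasurableSet) ⟨0, measure_ne_top _ _⟩
  refine le_trans (le_iInf hET) (h3.symm.le.trans (measure_mono fun ω hω => ?_))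
  have h4 : ∀ T, countBefore (IsBad M Λ.policy ε ω) T < K := fun T => Set.mem_iInter.1 hω T
  have hK0 : 0 < K := lt_of_le_of_lt (Nat.zero_le _) (h4 0)
  have h5 := ncard_le_of_countBefore_le (K := K - 1) fun T => Nat.le_sub_one_of_lt (h4 T)
  exact ⟨h5.1, lt_of_le_of_lt h5.2 (Nat.sub_lt hK0 one_pos)⟩

end Probability

/-! ### Comparison of the constants. -/

section Constants

/-- For `a ≥ 1` the index `1` fails, since `z 1 = 0`; so both `0` and `z 2 = 2` occur. -/
lemma two_le_card_Z {a : ℕ} (ha : 1 ≤ a) : 2 ≤ (Z a).card := by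
  have hne : {i : ℕ | 1 ≤ i ∧ a ≤ z i}.Nonempty := by
    refine ⟨a + 2, by omega, ?_⟩
    have : a + 2 < 2 ^ (a + 2) := Nat.lt_two_pow_self
    unfold z
    omega
  have hmem := Nat.sInf_mem hne
  have h2 : 2 ≤ sInf {i : ℕ | 1 ≤ i ∧ a ≤ z i} := by
    by_contra h
    have h1 : sInf {i : ℕ | 1 ≤ i ∧ a ≤ z i} = 1 := by
      have := hmem.1
      omega
    rw [h1] at hmem
    have : a ≤ z 1 := hmem.2
    simp [z] at this
    omega
  have hsub : ({0, 2} : Finset ℕ) ⊆ Z a := by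
    intro j hj
    simp only [Finset.mem_insert, Finset.mem_singleton] at hj
    unfold Z
    rcases hj with rfl | rfl
    · exact Finset.mem_image.2 ⟨1, Finset.mem_Icc.2 ⟨le_rfl, by omega⟩, rfl⟩
    · exact Finset.mem_image.2 ⟨2, Finset.mem_Icc.2 ⟨by norm_num, h2⟩, rfl⟩
  simpa using Finset.card_le_card hsub

/-- The logarithm that governs the number of samples that the learner needs. -/
noncomputable def logScale (n : ℕ) (ε γ : ℝ) : ℝ := Real.log (8 * n / (ε * (1 - γ) ^ 2))

variable {n a : ℕ} {ε δ γ : ℝ}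

lemma sixteen_mul_le (hn : 2 ≤ n) (hγ : γ ∈ Set.Ioo (0 : ℝ) 1) (hε : 0 < ε)
    (hε' : ε ≤ 1 / (1 - γ)) :
    16 ≤ 8 * n / (ε * (1 - γ)) ∧ 8 * n / (ε * (1 - γ)) ≤ 8 * n / (ε * (1 - γ) ^ 2) := by
  have h1 : 0 < 1 - γ := by linarith [hγ.2]
  have h2 : 1 - γ ≤ 1 := by linarith [hγ.1]
  have h3 : ε * (1 - γ) ≤ 1 := by rwa [le_div_iff₀ h1] at hε'
  have hn' : (2 : ℝ) ≤ n := by exact_mod_cast hn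
  constructor
  · rw [le_div_iff₀ (by positivity)]
    linarith
  · refine div_le_div_of_nonneg_left (by positivity) (by positivity) ?_
    refine mul_le_mul_of_nonneg_left ?_ hε.le
    nlinarith

lemma log_sixteen : Real.log 16 = 4 * Real.log 2 := by
  rw [show (16 : ℝ) = 2 ^ 4 by norm_num, Real.log_pow]
  norm_num

lemma log_sixteen_le_logScale (hn : 2 ≤ n) (hγ : γ ∈ Set.Ioo (0 : ℝ) 1) (hε : 0 < ε)
    (hε' : ε ≤ 1 / (1 - γ)) : 4 * Real.log 2 ≤ logScale n ε γ := by
  obtain ⟨h1, h2⟩ := sixteen_mul_le hn hγ hε hε'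
  rw [← log_sixteen]
  exact Real.log_le_log (by norm_num) (h1.trans h2)

/-- The square of `cardKI` in the stated bound will pay for `logScale ^ 2`. -/
lemma two_mul_le_cardKI (hn : 2 ≤ n) :
    2 * (logScale n ε γ / Real.log 2 + 1) ≤ cardKI n ε γ := by
  unfold cardKI
  have h1 : (2 : ℝ) ≤ (Z n).card := by exact_mod_cast two_le_card_Z (by omega)
  have h2 : logScale n ε γ / Real.log 2 ≤ iotaMax n ε γ := by
    unfold iotaMax logScale
    refine le_trans (le_of_eq ?_) (Nat.le_ceil _)
    ring
  rw [Finset.card_range]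
  push_cast
  have h3 : (0 : ℝ) ≤ iotaMax n ε γ := Nat.cast_nonneg _
  calc _ ≤ 2 * ((iotaMax n ε γ : ℝ) + 1) := by linarith
    _ ≤ _ := mul_le_mul_of_nonneg_right h1 (by linarith)

lemma ten_le_cardKI (hn : 2 ≤ n) (hγ : γ ∈ Set.Ioo (0 : ℝ) 1) (hε : 0 < ε)
    (hε' : ε ≤ 1 / (1 - γ)) : (10 : ℝ) ≤ cardKI n ε γ := by
  have h1 := log_sixteen_le_logScale hn hγ hε hε'
  have h2 : 4 ≤ logScale n ε γ / Real.log 2 := by rwa [le_div_iff₀ (Real.log_pos (by norm_num))]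
  linarith [two_mul_le_cardKI (ε := ε) (γ := γ) hn]

lemma exp_L1 (hn : 2 ≤ n) (ha : 1 ≤ a) (hγ : γ ∈ Set.Ioo (0 : ℝ) 1) (hε : 0 < ε)
    (hε' : ε ≤ 1 / (1 - γ)) (hδ : 0 < δ) :
    Real.exp (L1 n a ε δ γ) = 4 * (n * a) ^ 2 * cardKI n ε γ / δ := by
  have h1 := ten_le_cardKI hn hγ hε hε'
  have h2 : (0 : ℝ) < cardKI n ε γ := by linarith
  have hn' : (0 : ℝ) < n := by exact_mod_cast (by omega : 0 < n)
  have ha' : (0 : ℝ) < a := by exact_mod_cast (by omega : 0 < a)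
  unfold L1 delta1 Umax
  rw [Real.exp_log (by positivity)]
  field_simp
  norm_num

lemma five_le_L1 (hn : 2 ≤ n) (ha : 1 ≤ a) (hγ : γ ∈ Set.Ioo (0 : ℝ) 1) (hε : 0 < ε)
    (hε' : ε ≤ 1 / (1 - γ)) (hδ : 0 < δ) (hδ' : δ < 1) : 5 ≤ L1 n a ε δ γ := by
  rw [← Real.exp_le_exp, exp_L1 hn ha hγ hε hε' hδ]
  have h1 := ten_le_cardKI hn hγ hε hε'
  have hn' : (2 : ℝ) ≤ n := by exact_mod_cast hn
  have ha' : (1 : ℝ) ≤ a := by exact_mod_cast ha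
  have h2 : Real.exp 5 ≤ 160 := by
    have h3 : Real.exp 5 = Real.exp 1 ^ 5 := by rw [← Real.exp_nat_mul]; norm_num
    rw [h3]
    have h4 := Real.exp_one_lt_d9.le
    calc Real.exp 1 ^ 5 ≤ 2.7182818286 ^ 5 := pow_le_pow_left₀ (Real.exp_pos 1).le h4 5
      _ ≤ 160 := by norm_num
  rw [le_div_iff₀ hδ]
  have h3 : 2 ≤ (n * a : ℝ) := by nlinarith
  have h4 : (4 : ℝ) ≤ (n * a) ^ 2 := by nlinarith
  -- The product is `160`, just above `exp 5`.
  have h5 : (4 : ℝ) * 4 * 10 ≤ 4 * (n * a) ^ 2 * cardKI n ε γ :=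
    mul_le_mul (by linarith) h1 (by norm_num) (by positivity)
  nlinarith [Real.exp_pos 5]

/-- The bound of the theorem dominates the sample complexity of the learner. -/
lemma sampleComplexity_le (hn : 2 ≤ n) (ha : 1 ≤ a) (hγ : γ ∈ Set.Ioo (0 : ℝ) 1) (hε : 0 < ε)
    (hε' : ε ≤ 1 / (1 - γ)) (hδ : 0 < δ) (hδ' : δ < 1) :
    12000 * (n ^ 2 * a * (1 / (1 - γ)) ^ 3 * L1 n a ε δ γ * logScale n ε γ ^ 2) / ε ^ 2 ≤
      n * Real.log n ^ 3 * (Emax n a ε δ γ * horizon n ε γ + Umax n a ε γ * horizon n ε γ) := by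
  have hn' : (2 : ℝ) ≤ n := by exact_mod_cast hn
  have ha' : (1 : ℝ) ≤ a := by exact_mod_cast ha
  have hγ' : 0 < 1 - γ := by linarith [hγ.2]
  have hL := five_le_L1 hn ha hγ hε hε' hδ hδ'
  have hx := log_sixteen_le_logScale hn hγ hε hε'
  have hl : 0.69 ≤ Real.log 2 := by linarith [Real.log_two_gt_d9]
  have hl0 : 0 < Real.log 2 := by linarith
  have hKI := two_mul_le_cardKI (ε := ε) (γ := γ) hn
  set L := L1 n a ε δ γ with hLdef
  set x := logScale n ε γ with hxdef
  set q : ℝ := (cardKI n ε γ : ℝ) with hq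
  set G := 1 / (1 - γ) with hG
  have hG0 : 0 < G := by positivity
  have hq1 : 4 * (x ^ 2 / Real.log 2 ^ 2) ≤ q ^ 2 := by
    have h1 : 2 * (x / Real.log 2) ≤ q := by linarith
    have h2 : 0 ≤ 2 * (x / Real.log 2) := by
      have : 0 ≤ x := by linarith
      positivity
    calc _ = (2 * (x / Real.log 2)) ^ 2 := by ring
      _ ≤ q ^ 2 := pow_le_pow_left₀ h2 h1 2
  have hβ : 1 ≤ beta γ := by
    refine Nat.one_le_ceil_iff.2 (mul_pos (by positivity) (Real.log_pos ?_))
    rw [lt_div_iff₀ hγ']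
    linarith [hγ.1]
  have hD : (4 : ℝ) ≤ (cardD γ : ℝ) ^ 2 := by
    have : (2 : ℝ) ≤ cardD γ := by exact_mod_cast two_le_card_Z hβ
    nlinarith
  have hpow : (1 - γ) ^ (2 + 2 / (beta γ : ℝ)) ≤ 1 / G ^ 2 := by
    have h1 : (1 - γ) ^ (2 + 2 / (beta γ : ℝ)) ≤ (1 - γ) ^ (2 : ℝ) :=
      Real.rpow_le_rpow_of_exponent_ge hγ' (by linarith [hγ.1])
        (by linarith [show 0 ≤ 2 / (beta γ : ℝ) by positivity])
    refine h1.trans (le_of_eq ?_)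
    rw [Real.rpow_two, hG]
    field_simp
  have hm : 80 * L * q * G ^ 2 / ε ^ 2 ≤ mConst n a ε δ γ := by
    unfold mConst
    have h1 : 0 < (1 - γ) ^ (2 + 2 / (beta γ : ℝ)) := Real.rpow_pos_of_pos hγ' _
    rw [← hLdef, ← hq, le_div_iff₀ (by positivity)]
    have h2 : 0 ≤ L * q := mul_nonneg (by linarith) (Nat.cast_nonneg _)
    calc 80 * L * q * G ^ 2 / ε ^ 2 * (ε ^ 2 * (1 - γ) ^ (2 + 2 / (beta γ : ℝ)))
        = 80 * (L * q) * G ^ 2 * (1 - γ) ^ (2 + 2 / (beta γ : ℝ)) := by field_simp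
      _ ≤ 80 * (L * q) * G ^ 2 * (1 / G ^ 2) := mul_le_mul_of_nonneg_left hpow (by positivity)
      _ = 20 * (L * q) * 4 := by field_simp; ring
      _ ≤ 20 * (L * q) * (cardD γ : ℝ) ^ 2 := mul_le_mul_of_nonneg_left hD (by positivity)
      _ = _ := by ring
  have hH : G * (4 * Real.log 2) ≤ horizon n ε γ := by
    unfold horizon
    rw [← hG, ← log_sixteen]
    exact mul_le_mul_of_nonneg_left
      (Real.log_le_log (by norm_num) (sixteen_mul_le hn hγ hε hε').1) hG0.le
  have hE : 24 * (n * a) * (80 * L * q * G ^ 2 / ε ^ 2) * q ≤ Emax n a ε δ γ := by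
    unfold Emax NConst
    rw [← hq]
    have h1 : 24 * (n * a : ℝ) * (80 * L * q * G ^ 2 / ε ^ 2) ≤
        24 * (n * a) * mConst n a ε δ γ := mul_le_mul_of_nonneg_left hm (by positivity)
    calc _ ≤ 24 * (n * a) * mConst n a ε δ γ * q :=
          mul_le_mul_of_nonneg_right h1 (Nat.cast_nonneg _)
      _ = _ := by ring
  have hU : 0 ≤ Umax n a ε γ := by unfold Umax; positivity
  have hHn : 0 ≤ horizon n ε γ := le_trans (by positivity) hH
  have hlog : Real.log 2 ^ 3 ≤ Real.log n ^ 3 :=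
    pow_le_pow_left₀ hl0.le (Real.log_le_log (by norm_num) hn') 3
  have hL0 : 0 ≤ L := by linarith
  have h1 : 24 * (n * a) * (80 * L * q * G ^ 2 / ε ^ 2) * q * (G * (4 * Real.log 2)) ≤
      Emax n a ε δ γ * horizon n ε γ + Umax n a ε γ * horizon n ε γ := by
    have := mul_le_mul hE hH (by positivity) (le_trans (by positivity) hE)
    linarith [mul_nonneg hU hHn]
  have h2 : n * Real.log 2 ^ 3 * (24 * (n * a) * (80 * L * q * G ^ 2 / ε ^ 2) * q *
      (G * (4 * Real.log 2))) ≤ n * Real.log n ^ 3 *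
      (Emax n a ε δ γ * horizon n ε γ + Umax n a ε γ * horizon n ε γ) :=
    mul_le_mul (mul_le_mul_of_nonneg_left hlog (by positivity)) h1 (by positivity)
      (mul_nonneg (by positivity) (le_trans (by positivity) hlog))
  refine le_trans ?_ h2
  -- Here `7680 = 24 * 80 * 4` comes from `Emax` and `horizon`, and `q ^ 2` gives another `4`. Three
  -- factors `log 2` come from `log n` and one from `horizon`; two are spent on `q ^ 2`, and `30720
  -- * 0.69 ^ 2 > 12000`.
  calc 12000 * (n ^ 2 * a * G ^ 3 * L * x ^ 2) / ε ^ 2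
      ≤ 30720 * Real.log 2 ^ 2 * (n ^ 2 * a * G ^ 3 * L * x ^ 2) / ε ^ 2 := by
        refine div_le_div_of_nonneg_right (mul_le_mul_of_nonneg_right ?_ (by positivity))
          (by positivity)
        nlinarith
    _ = 7680 * (n ^ 2 * a * G ^ 3 * L / ε ^ 2) * Real.log 2 ^ 4 *
          (4 * (x ^ 2 / Real.log 2 ^ 2)) := by field_simp; ring
    _ ≤ 7680 * (n ^ 2 * a * G ^ 3 * L / ε ^ 2) * Real.log 2 ^ 4 * q ^ 2 :=
        mul_le_mul_of_nonneg_left hq1 (by positivity)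
    _ = _ := by ring

/-- The arithmetic behind the choice of the parameters of the learner. -/
lemma parameter_arithmetic {n a G ε x L W N K P : ℝ} (hn : 2 ≤ n) (ha : 1 ≤ a) (hG : 1 ≤ G)
    (hε : 0 < ε) (hεG : ε ≤ G) (hx : 2.7 ≤ x) (hxe : Real.exp x = 8 * n * G ^ 2 / ε) (hL : 5 ≤ L)
    (hW : W = 2 * L * x) (hN : N ≤ W * Real.exp (5 * x)) (hN' : W * Real.exp (5 * x) < N + 1)
    (hP : P = 6 * n ^ 2 * a * G * W * x) (hK : K ≤ 1000 * (P * G ^ 2) / ε ^ 2 + 1) :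
    W ≤ N ∧ n * (G * (n * a * (W + 3 + W * Real.log (N / W))) + G * K * (W / N)) ≤ P ∧
      60 * (G * W) ≤ P ∧ 100 * (n * G) ≤ P := by
  have hG0 : 0 < G := by linarith
  have hW27 : 27 ≤ W := by rw [hW]; nlinarith
  have hW0 : 0 < W := by linarith
  set E := Real.exp x with hE
  have hE5 : Real.exp (5 * x) = E ^ 5 := by rw [hE, ← Real.exp_nat_mul]; norm_num
  rw [hE5] at hN hN'
  have hE16 : 16 ≤ E := by
    rw [hxe, le_div_iff₀ hε]
    have h1 := mul_le_mul hn hεG hε.le (by linarith)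
    have h2 := mul_le_mul_of_nonneg_left hG (show 0 ≤ n * G by positivity)
    linarith
  have hE5' : 16 ^ 5 ≤ E ^ 5 := pow_le_pow_left₀ (by norm_num) hE16 5
  have hWE : 27 * 16 ^ 5 ≤ W * E ^ 5 := mul_le_mul hW27 hE5' (by norm_num) hW0.le
  have hWE' : W * 16 ^ 5 ≤ W * E ^ 5 := mul_le_mul_of_nonneg_left hE5' hW0.le
  have hNhalf : W * E ^ 5 / 2 ≤ N := by linarith
  have hN0 : 0 < N := lt_of_lt_of_le (by positivity) hNhalf
  have hWN : W ≤ N := by linarith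
  have hlog : Real.log (N / W) ≤ 5 * x := by
    rw [Real.log_le_iff_le_exp (by positivity), hE5, div_le_iff₀ hW0]
    linarith
  have hxE : x ≤ E := by linarith [Real.add_one_le_exp x]
  have hna : 2 ≤ n * a := by nlinarith
  have h60 : 60 * (G * W) ≤ P := by
    rw [hP]
    have h1 : 10.8 ≤ n ^ 2 * a * x := by
      have h2 : 4 ≤ n ^ 2 * a := by nlinarith
      nlinarith
    have := mul_le_mul_of_nonneg_left h1 (show 0 ≤ 6 * (G * W) by positivity)
    linarith [mul_pos hG0 hW0]
  have h100 : 100 * (n * G) ≤ P := by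
    rw [hP]
    have h1 : 27 * 2.7 ≤ W * x := mul_le_mul hW27 hx (by norm_num) hW0.le
    have h2 : 2 * (27 * 2.7) ≤ n * a * (W * x) := mul_le_mul hna h1 (by norm_num) (by linarith)
    have := mul_le_mul_of_nonneg_left h2 (show 0 ≤ 6 * (n * G) by positivity)
    linarith [mul_pos (show 0 < n by linarith) hG0]
  have hrat : n * G ^ 3 / ε ^ 2 ≤ E ^ 2 / 128 := by
    rw [hxe]
    have : (8 * n * G ^ 2 / ε) ^ 2 / 128 = n * G ^ 3 / ε ^ 2 * (n * G / 2) := by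
      field_simp
      norm_num
    rw [this]
    refine le_mul_of_one_le_right (by positivity) ?_
    linarith [mul_le_mul hn hG zero_le_one (by linarith)]
  -- This is what the exponent `5` of the cap is for: `K` is of order `n a W E ^ 3`, while `N` is at
  -- least `W E ^ 5 / 2` and `E ≥ 16`. The capped widths thus cost at most one more `W` per pair.
  have hKW : K * (W / N) ≤ n * a * W := by
    have h1 : 1000 * (P * G ^ 2) / ε ^ 2 = 6000 * (n * a * W * x) * (n * G ^ 3 / ε ^ 2) := by
      rw [hP]
      ring
    have hpos : 0 ≤ n * a * W * x := by positivity
    have h2 : K ≤ 6000 * (n * a * W * x) * (E ^ 2 / 128) + 1 := by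
      refine hK.trans ?_
      rw [h1]
      have := mul_le_mul_of_nonneg_left hrat (show 0 ≤ 6000 * (n * a * W * x) by positivity)
      linarith
    have h3 : n * a * W * x * E ^ 2 ≤ n * a * W * E ^ 3 := by
      have := mul_le_mul_of_nonneg_left hxE (show 0 ≤ n * a * W * E ^ 2 by positivity)
      linarith
    have h4 : 256 * E ^ 3 ≤ E ^ 5 := by
      have h6 : 16 ^ 2 ≤ E ^ 2 := pow_le_pow_left₀ (by norm_num) hE16 2
      have h7 := mul_le_mul_of_nonneg_right h6 (show 0 ≤ E ^ 3 by positivity)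
      linarith
    have h5 : K ≤ n * a * W * E ^ 5 / 2 := by
      have h6 := mul_le_mul_of_nonneg_left h4 (show 0 ≤ n * a * W by positivity)
      have h7 : 54 * 16 ^ 5 ≤ n * a * W * E ^ 5 :=
        mul_le_mul (by linarith [mul_le_mul hna hW27 (by norm_num) (by linarith)]) hE5'
          (by norm_num) (by positivity)
      linarith
    rw [← mul_div_assoc, div_le_iff₀ hN0]
    have h8 := mul_le_mul_of_nonneg_right h5 hW0.le
    have h9 := mul_le_mul_of_nonneg_left hNhalf (show 0 ≤ n * a * W by positivity)
    linarith
  refine ⟨hWN, ?_, h60, h100⟩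
  have h1 : W * Real.log (N / W) ≤ 5 * (W * x) := by
    have := mul_le_mul_of_nonneg_left hlog hW0.le
    linarith
  have h2 : W + 3 + W * Real.log (N / W) + W ≤ 6 * (W * x) := by
    linarith [mul_le_mul_of_nonneg_left hx hW0.le]
  have h3 : n * (G * (n * a * (W + 3 + W * Real.log (N / W))) + G * K * (W / N)) ≤
      n * G * (n * a * (W + 3 + W * Real.log (N / W) + W)) := by
    have := mul_le_mul_of_nonneg_left hKW (show 0 ≤ n * G by positivity)
    linarith
  refine h3.trans ?_
  have := mul_le_mul_of_nonneg_left h2 (show 0 ≤ n * G * (n * a) by positivity)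
  rw [hP]
  linarith

/-- The width of the confidence sets makes the exceptional events unlikely. -/
lemma confidence_arithmetic {n a q δ x L W N : ℝ} (hn : 2 ≤ n) (ha : 1 ≤ a) (hδ : 0 < δ)
    (hq : 10 ≤ q) (hx : 2.7 ≤ x) (hL : 5 ≤ L) (hLe : Real.exp L = 4 * (n * a) ^ 2 * q / δ)
    (hW : W = 2 * L * x) (hN : N ≤ W * Real.exp (5 * x)) :
    (2 * (n ^ 2 * a * (N + 1)) + 3) * Real.exp (-W) ≤ δ := by
  have hW27 : 27 ≤ W := by rw [hW]; nlinarith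
  have h1 : 40 * (n ^ 2 * a) ≤ δ * Real.exp L := by
    rw [hLe, mul_div_cancel₀ _ hδ.ne']
    have h2 : n ^ 2 * a ≤ (n * a) ^ 2 := by
      have : (n * a) ^ 2 = n ^ 2 * a * a := by ring
      rw [this]
      exact le_mul_of_one_le_right (by positivity) ha
    have h3 := mul_le_mul h2 hq (by norm_num) (by positivity)
    linarith
  -- In `W = 2 L x`, the part `L` pays for `δ` and the number of triples `(s, a, s')`, the part `5
  -- x` for the exponential in the cap, and the remaining `0.3 W` for the factor `W` in the cap.
  have hc : W ≤ 4 * Real.exp (W - 5 * x - L) := by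
    have h2 := Real.add_one_le_exp (W - 5 * x - L)
    have h3 : 0.3 * W ≤ W - 5 * x - L := by rw [hW]; nlinarith
    linarith
  have h5 : 1 ≤ Real.exp (5 * x) := Real.one_le_exp (by linarith)
  have hna : 4 ≤ n ^ 2 * a := by nlinarith
  have h6 : 2 * (n ^ 2 * a * (N + 1)) + 3 ≤ 4 * (n ^ 2 * a) * (W * Real.exp (5 * x)) := by
    have h7 : 27 ≤ W * Real.exp (5 * x) := by nlinarith
    have h8 := mul_le_mul_of_nonneg_left hN (show 0 ≤ n ^ 2 * a by positivity)
    nlinarith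
  rw [Real.exp_neg, ← div_eq_mul_inv, div_le_iff₀ (Real.exp_pos W)]
  have h9 : Real.exp (W - 5 * x - L) * Real.exp (5 * x) * Real.exp L = Real.exp W := by
    rw [← Real.exp_add, ← Real.exp_add]
    ring_nf
  have h10 : 4 * (n ^ 2 * a) * (W * Real.exp (5 * x)) ≤
      4 * (n ^ 2 * a) * (4 * Real.exp (W - 5 * x - L) * Real.exp (5 * x)) :=
    mul_le_mul_of_nonneg_left (mul_le_mul_of_nonneg_right hc (Real.exp_pos _).le) (by positivity)
  have h11 := mul_le_mul_of_nonneg_right h1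
    (show 0 ≤ Real.exp (W - 5 * x - L) * Real.exp (5 * x) by positivity)
  have h12 : δ * Real.exp L * (Real.exp (W - 5 * x - L) * Real.exp (5 * x)) =
      δ * Real.exp W := by rw [← h9]; ring
  have h13 : 0 ≤ n ^ 2 * a * (Real.exp (W - 5 * x - L) * Real.exp (5 * x)) := by positivity
  linarith

end Constants

end PACMDP

/-! ### Choice of the parameters. -/

theorem theorem2 {S A : Type*} [Fintype S] [Fintype A] [Nonempty A]
    [MeasurableSpace S] [DiscreteMeasurableSpace S]
    (r : S → ℝ) (γ ε δ : ℝ)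
    (hr : ∀ s, r s ∈ Set.Icc (0 : ℝ) 1) (hγ : γ ∈ Set.Ioo (0 : ℝ) 1)
    (hε : 0 < ε) (hε' : ε ≤ 1 / (1 - γ)) (hδ : 0 < δ) (hδ' : δ < 1) :
    ∃ π : PACMDP.Policy S A, ∀ M : PACMDP.MDP S A, M.r = r → M.γ = γ → ∀ s₁ : S,
      ENNReal.ofReal (1 - δ) ≤
        PACMDP.processLaw M π s₁
          {ω | (PACMDP.badSteps M π ε ω).Finite ∧
            ((PACMDP.badSteps M π ε ω).ncard : ℝ) ≤
              (Fintype.card S : ℝ) * Real.log (Fintype.card S) ^ 3 *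
                (PACMDP.Emax (Fintype.card S) (Fintype.card A) ε δ γ *
                    PACMDP.horizon (Fintype.card S) ε γ +
                  PACMDP.Umax (Fintype.card S) (Fintype.card A) ε γ *
                    PACMDP.horizon (Fintype.card S) ε γ)} := by
  open PACMDP in
  -- For one state the bound is `0`, but every policy is optimal. Otherwise `log |S| ≥ log 2`.
  rcases lt_or_ge (Fintype.card S) 2 with hn | hn
  · refine ⟨fun _ _ => Classical.arbitrary A, fun M _ _ s₁ => ?_⟩
    have hcard : Fintype.card S = 1 := by
      have : 0 < Fintype.card S := Fintype.card_pos_iff.2 ⟨s₁⟩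
      omega
    have hsub : Subsingleton S := Fintype.card_le_one_iff_subsingleton.1 hcard.le
    have h1 : ∀ ω, badSteps M (fun _ _ => Classical.arbitrary A) ε ω = ∅ := by
      intro ω
      refine Set.eq_empty_iff_forall_notMem.2 fun t ht => ?_
      have h2 : ε < _ - _ := ht
      rw [optValue_eq_value_of_subsingleton M _ _ (hist ω t), sub_self] at h2
      exact lt_asymm h2 hε
    simp only [h1, hcard]
    simp [hδ.le]
  · have ha : 1 ≤ Fintype.card A := Fintype.card_pos
    have hγ1 : 0 < 1 - γ := by linarith [hγ.2]
    set x := logScale (Fintype.card S) ε γ with hx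
    set L := L1 (Fintype.card S) (Fintype.card A) ε δ γ with hL
    set W := 2 * L * x with hW
    set N := ⌊W * Real.exp (5 * x)⌋₊ with hN
    set G := 1 / (1 - γ) with hG
    -- `P` bounds `|S|` times the weighted sum of the squared widths, and `K₀` is the least `K` that
    -- `gap_arithmetic` admits for it.
    set P := 6 * (Fintype.card S : ℝ) ^ 2 * Fintype.card A * G * W * x with hP
    set K₀ := 1000 * (P * G ^ 2) / ε ^ 2 with hK₀
    have hn' : (2 : ℝ) ≤ Fintype.card S := by exact_mod_cast hn
    have ha' : (1 : ℝ) ≤ Fintype.card A := by exact_mod_cast ha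
    have hG1 : 1 ≤ G := by rw [hG, le_div_iff₀ hγ1]; linarith [hγ.1]
    have hG0 : 0 < G := by linarith
    have hx27 : 2.7 ≤ x := by
      linarith [log_sixteen_le_logScale hn hγ hε hε', Real.log_two_gt_d9]
    have hL5 : 5 ≤ L := five_le_L1 hn ha hγ hε hε' hδ hδ'
    have hW1 : 1 ≤ W := by rw [hW]; nlinarith
    have hxe : Real.exp x = 8 * Fintype.card S * G ^ 2 / ε := by
      rw [hx, logScale, Real.exp_log (by positivity), hG]
      field_simp
    have hN1 : (N : ℝ) ≤ W * Real.exp (5 * x) := Nat.floor_le (by positivity)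
    have hN2 : W * Real.exp (5 * x) < N + 1 := Nat.lt_floor_add_one _
    have hK₀0 : 0 ≤ K₀ := by positivity
    have hK1 : ((⌊K₀⌋₊ + 1 : ℕ) : ℝ) ≤ K₀ + 1 := by
      push_cast
      linarith [Nat.floor_le hK₀0]
    have hK2 : K₀ ≤ ((⌊K₀⌋₊ + 1 : ℕ) : ℝ) := by
      push_cast
      exact (Nat.lt_floor_add_one K₀).le
    obtain ⟨h1, h2, h3, h4⟩ := parameter_arithmetic hn' ha' hG1 hε hε' hx27 hxe hL5 hW hN1 hN2 hP
      hK1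
    have h5 := confidence_arithmetic hn' ha' hδ (ten_le_cardKI hn hγ hε hε') hx27 hL5
      (exp_L1 hn ha hγ hε hε' hδ) hW hN1
    refine ⟨(⟨r, γ, W, N⟩ : Learner S).policy, fun M hMr hMγ s₁ => ?_⟩
    have hbound : K₀ ≤ Fintype.card S * Real.log (Fintype.card S) ^ 3 *
        (Emax (Fintype.card S) (Fintype.card A) ε δ γ * horizon (Fintype.card S) ε γ +
          Umax (Fintype.card S) (Fintype.card A) ε γ * horizon (Fintype.card S) ε γ) := by
      refine le_trans (le_of_eq ?_) (sampleComplexity_le hn ha hγ hε hε' hδ hδ')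
      rw [hK₀, hP, hW, ← hL, ← hx, ← hG]
      ring
    have h6 := Learner.processLaw_ncard_badSteps_lt (Λ := ⟨r, γ, W, N⟩) (M := M)
      ⟨hMr.symm, hMγ.symm⟩ hW1 hε (by rw [hMγ]; exact hε') (K := ⌊K₀⌋₊ + 1) (P := P) h1
      (by rw [hMγ]; exact h2) (by rw [hMγ]; exact h3) (by rw [hMγ]; exact h4)
      (by rw [hMγ]; exact hK2) h5 s₁
    refine h6.trans (measure_mono fun ω hω => ⟨hω.1, ?_⟩)
    -- Fewer than `⌊K₀⌋₊ + 1` bad times means at most `K₀`, so rounding costs nothing.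
    have h7 : (badSteps M (⟨r, γ, W, N⟩ : Learner S).policy ε ω).ncard ≤ ⌊K₀⌋₊ :=
      Nat.lt_succ_iff.1 hω.2
    exact ((Nat.le_floor_iff hK₀0).1 h7).trans hbound
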